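/- Let $m\ge 2$ and $n\ge 10$ be integers. A *product state* of $\mathbb{C}^{d_1}\otimes\mathbb{C}^{d_2}$ is a vector $a\otimes b$ with unit vectors $a\in\mathbb{C}^{d_1}$, $b\in\mathbb{C}^{d_2}$. A *$k$-member unextendible product basis (UPB)* in $\mathbb{C}^{d_1}\otimes\mathbb{C}^{d_2}$ is a family of $k<d_1d_2$ orthonormal product states such that no product state is orthogonal to all of them; its *missing states number* is $d_1d_2-k$. Then for every integer $s$ with $4\le s\le(2m-1)(n-8)$ there is a UPB in $\mathbb{C}^{2m}\otimes\mathbb{C}^{n}$ with missing states number $s$, i.e. a UPB with exactly $2mn-s$ members. -/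

import Mathlib

open scoped TensorProduct

/-- The bipartite space `ℂ^m ⊗ ℂ^n`, with the tensor product inner product
`⟪a ⊗ b, c ⊗ d⟫ = ⟪a, c⟫ * ⟪b, d⟫`. -/
abbrev BipartiteSpace (m n : ℕ) : Type :=
  EuclideanSpace ℂ (Fin m) ⊗[ℂ] EuclideanSpace ℂ (Fin n)

/-- A product state: a tensor product of two unit vectors. -/
def IsProductState {m n : ℕ} (ψ : BipartiteSpace m n) : Prop :=
  ∃ (a : EuclideanSpace ℂ (Fin m)) (b : EuclideanSpace ℂ (Fin n)),
    ‖a‖ = 1 ∧ ‖b‖ = 1 ∧ ψ = a ⊗ₜ[ℂ] b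

/-- A `k`-member unextendible product basis in `ℂ^m ⊗ ℂ^n`: `k < mn` orthonormal product states
such that no product state is orthogonal to all of them. -/
structure IsUPB {m n k : ℕ} (φ : Fin k → BipartiteSpace m n) : Prop where
  card_lt : k < m * n
  product : ∀ i, IsProductState (φ i)
  orthonormal : Orthonormal ℂ φ
  unextendible : ∀ ψ : BipartiteSpace m n, (∀ i, inner ℂ (φ i) ψ = 0) → ¬ IsProductState ψ

/-- There is a UPB in `ℂ^m ⊗ ℂ^n` with missing states number `s`, that is,
with `k` members where `mn - k = s`. -/
def HasUPBWithMissing (m n s : ℕ) : Prop :=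
  ∃ (k : ℕ) (φ : Fin k → BipartiteSpace m n), IsUPB φ ∧ k + s = m * n

/-! Missing numbers add when families are placed on complementary coordinates of one factor
(`Realizable.add`), and padding with a full product basis adds nothing. So it suffices to tile the
columns of the `2m` by `n` grid with blocks whose missing numbers sum to `s`.

The main block is a family in `ℂ^d ⊗ ℂ^n` with only `d + n - 1` members, hence missing `(d - 1) * (n
- 1)` (`realizable_minimal`). With `d = N + 2` it has `2 * h` members, in two cycles indexed by
residues `p`, `q` mod `h`. The left vectors are weighted points of a moment curve, the weights being
Gaussian binomials. By the q-binomial theorem `p` and `q` are orthogonal on the left when `q - p`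
lies in `{0, ..., N}` mod `h`. On the right, each cycle is an orthogonal system of Fourier type. The
two are coupled by a multiplier whose Fourier series is supported on `{0, ..., N}`, so `p` and `q`
are orthogonal on the right for all other differences.

The second cycle needs an extra coordinate wherever the multiplier is not unimodular. Taking the
multiplier from Lagrange interpolation at `N + 1` nodes makes it unimodular at the frequencies `0,
..., N`, which leaves exactly the `n` coordinates wanted. The analytic core is that its modulus is
below `1` at the remaining frequencies (`norm_symbol_lt_one`). Unextendibility is a count: a nonzero
`x` is orthogonal to at most `N + 1` left vectors, while a nonzero `y` is non-orthogonal to at least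
`N + 2` right ones.

A minimal block loses one column against the ideal rate of `D - 1` per column. Up to a bounded
remainder `s` is met by one such block; the remainder is built from small tilings and costs seven
more columns, whence `n - 8`. -/

open Matrix

/-! ### Unextendible families and their direct sums -/

/-- A family of product vectors `a i ⊗ b i` that are pairwise orthogonal and such that no nonzero
product vector is orthogonal to all of them. -/
structure IsUnextendibleFamily {ι α β : Type} [Fintype α] [Fintype β]
    (a : ι → α → ℂ) (b : ι → β → ℂ) : Prop where
  left_ne : ∀ i, a i ≠ 0
  right_ne : ∀ i, b i ≠ 0
  orth : ∀ i j, i ≠ j → star (a i) ⬝ᵥ a j = 0 ∨ star (b i) ⬝ᵥ b j = 0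
  unext : ∀ x y, (∀ i, star (a i) ⬝ᵥ x = 0 ∨ star (b i) ⬝ᵥ y = 0) → x = 0 ∨ y = 0

/-- There is an unextendible family in `ℂ^D ⊗ ℂ^n` with `D * n - s` members; unlike for a UPB,
`s = 0` is allowed. -/
def Realizable (D n s : ℕ) : Prop :=
  ∃ (k : ℕ) (a : Fin k → Fin D → ℂ) (b : Fin k → Fin n → ℂ),
    IsUnextendibleFamily a b ∧ k + s = D * n

theorem IsUnextendibleFamily.swap {ι α β : Type} [Fintype α] [Fintype β]
    {a : ι → α → ℂ} {b : ι → β → ℂ} (h : IsUnextendibleFamily a b) :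
    IsUnextendibleFamily b a :=
  ⟨h.right_ne, h.left_ne, fun i j hij => (h.orth i j hij).symm,
    fun x y hxy => (h.unext y x fun i => (hxy i).symm).symm⟩

theorem IsUnextendibleFamily.reindex {ι κ α β α' β' : Type} [Fintype α] [Fintype β]
    [Fintype α'] [Fintype β'] {a : ι → α → ℂ} {b : ι → β → ℂ} (h : IsUnextendibleFamily a b)
    (f : κ ≃ ι) (g : α' ≃ α) (g' : β' ≃ β) :
    IsUnextendibleFamily (fun i => a (f i) ∘ g) (fun i => b (f i) ∘ g') := by
  have dot : ∀ {γ γ' : Type} [Fintype γ] [Fintype γ'] (g : γ' ≃ γ) (v w : γ → ℂ),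
      star (v ∘ g) ⬝ᵥ (w ∘ g) = star v ⬝ᵥ w := by
    intro γ γ' _ _ g v w
    simp only [dotProduct, Function.comp, Pi.star_apply]
    exact g.sum_comp (fun i => star (v i) * w i)
  have dot2 : ∀ {γ γ' : Type} [Fintype γ] [Fintype γ'] (g : γ' ≃ γ) (v : γ → ℂ) (w : γ' → ℂ),
      star (v ∘ g) ⬝ᵥ w = star v ⬝ᵥ (w ∘ g.symm) := by
    intro γ γ' _ _ g v w
    rw [← dot g]; congr 1; ext; simp
  have ne : ∀ {γ γ' : Type} (g : γ' ≃ γ) (v : γ → ℂ), v ∘ g = 0 → v = 0 := by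
    intro γ γ' g v hv
    ext i; simpa using congrFun hv (g.symm i)
  refine ⟨fun i hi => h.left_ne _ (ne g _ hi), fun i hi => h.right_ne _ (ne g' _ hi), ?_, ?_⟩
  · intro i j hij
    rw [dot g, dot g']
    exact h.orth _ _ (f.injective.ne hij)
  · intro x y hxy
    refine (h.unext (x ∘ g.symm) (y ∘ g'.symm) ?_).imp (ne g.symm _) (ne g'.symm _)
    intro i
    have := hxy (f.symm i)
    simpa only [f.apply_symm_apply, dot2] using this

theorem IsUnextendibleFamily.realizable {ι α β : Type} [Fintype ι] [Fintype α] [Fintype β]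
    {a : ι → α → ℂ} {b : ι → β → ℂ} (h : IsUnextendibleFamily a b) {D n s : ℕ}
    (hD : Fintype.card α = D) (hn : Fintype.card β = n) (hs : Fintype.card ι + s = D * n) :
    Realizable D n s :=
  ⟨Fintype.card ι, _, _, h.reindex (Fintype.equivFin ι).symm (Fintype.equivFinOfCardEq hD).symm
    (Fintype.equivFinOfCardEq hn).symm, hs⟩

theorem Realizable.swap {D n s : ℕ} (h : Realizable D n s) : Realizable n D s := by
  obtain ⟨k, a, b, hab, hk⟩ := h
  exact ⟨k, b, a, hab.swap, by rw [hk, mul_comm]⟩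

theorem Realizable.zero (D n : ℕ) : Realizable D n 0 := by
  have key : IsUnextendibleFamily (ι := Fin D × Fin n) (fun i => Pi.single i.1 (1 : ℂ))
      (fun i => Pi.single i.2 (1 : ℂ)) := by
    refine ⟨fun i => by simp, fun i => by simp, ?_, ?_⟩
    · rintro ⟨i, i'⟩ ⟨j, j'⟩ hij
      simp only [← Pi.single_star, single_dotProduct, star_one, one_mul]
      by_cases h : i = j
      · right
        rw [Pi.single_eq_of_ne]
        rintro rfl; exact hij (by rw [h])
      · left
        rw [Pi.single_eq_of_ne h]
    · intro x y h
      by_contra! hne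
      obtain ⟨i, hi⟩ := Function.ne_iff.1 hne.1
      obtain ⟨j, hj⟩ := Function.ne_iff.1 hne.2
      have := h (i, j)
      simp only [← Pi.single_star, single_dotProduct, star_one, one_mul] at this
      exact this.elim hi hj
  exact key.realizable (by simp) (by simp) (by simp)

/-- Members of different blocks have disjointly supported second factors. If `x ≠ 0`,
unextendibility of each block kills the corresponding restriction of `y`. -/
theorem Realizable.add {D n₁ n₂ s₁ s₂ : ℕ} (h₁ : Realizable D n₁ s₁) (h₂ : Realizable D n₂ s₂) :
    Realizable D (n₁ + n₂) (s₁ + s₂) := by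
  obtain ⟨k₁, a₁, b₁, H₁, hk₁⟩ := h₁
  obtain ⟨k₂, a₂, b₂, H₂, hk₂⟩ := h₂
  have sinl : ∀ (v : Fin n₁ → ℂ) (w : Fin n₁ ⊕ Fin n₂ → ℂ),
      star (Sum.elim v 0) ⬝ᵥ w = star v ⬝ᵥ (w ∘ Sum.inl) := by
    intro v w; simp [dotProduct]
  have sinr : ∀ (v : Fin n₂ → ℂ) (w : Fin n₁ ⊕ Fin n₂ → ℂ),
      star (Sum.elim 0 v) ⬝ᵥ w = star v ⬝ᵥ (w ∘ Sum.inr) := by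
    intro v w; simp [dotProduct]
  have key : IsUnextendibleFamily (ι := Fin k₁ ⊕ Fin k₂) (Sum.elim a₁ a₂)
      (Sum.elim (fun i => Sum.elim (b₁ i) (0 : Fin n₂ → ℂ))
        (fun i => Sum.elim (0 : Fin n₁ → ℂ) (b₂ i))) := by
    refine ⟨?_, ?_, ?_, ?_⟩
    · rintro (i | i)
      · exact H₁.left_ne i
      · exact H₂.left_ne i
    · rintro (i | i) h
      · exact H₁.right_ne i (funext fun j => congrFun h (Sum.inl j))
      · exact H₂.right_ne i (funext fun j => congrFun h (Sum.inr j))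
    · rintro (i | i) (j | j) hij <;> simp only [Sum.elim_inl, Sum.elim_inr, sinl, sinr]
      · exact H₁.orth i j fun h => hij (by rw [h])
      · right; simp
      · right; simp
      · exact H₂.orth i j fun h => hij (by rw [h])
    · intro x y h
      by_cases hx : x = 0
      · exact Or.inl hx
      right
      have e₁ := (H₁.unext x (y ∘ Sum.inl) fun i => by
        simpa only [Sum.elim_inl, sinl] using h (Sum.inl i)).resolve_left hx
      have e₂ := (H₂.unext x (y ∘ Sum.inr) fun i => by
        simpa only [Sum.elim_inr, sinr] using h (Sum.inr i)).resolve_left hx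
      ext (i | i)
      · exact congrFun e₁ i
      · exact congrFun e₂ i
  refine key.realizable (by simp) (by simp) ?_
  simp only [Fintype.card_sum, Fintype.card_fin]
  rw [mul_add, ← hk₁, ← hk₂]; ring

/-- Pads with full product bases; this is why `Realizable` admits `s = 0`. -/
theorem Realizable.mono {D D' n n' s : ℕ} (h : Realizable D n s) (hD : D ≤ D') (hn : n ≤ n') :
    Realizable D' n' s := by
  obtain ⟨j, rfl⟩ := Nat.exists_eq_add_of_le hD
  obtain ⟨k, rfl⟩ := Nat.exists_eq_add_of_le hn
  exact ((h.swap.add (Realizable.zero n j)).swap.add (Realizable.zero (D + j) k))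

theorem Realizable.add_rows {D₁ D₂ n s₁ s₂ : ℕ} (h₁ : Realizable D₁ n s₁)
    (h₂ : Realizable D₂ n s₂) : Realizable (D₁ + D₂) n (s₁ + s₂) :=
  (h₁.swap.add h₂.swap).swap

theorem Realizable.hasUPBWithMissing {D n s : ℕ} (h : Realizable D n s) (hs : 0 < s) :
    HasUPBWithMissing D n s := by
  obtain ⟨k, a, b, H, hk⟩ := h
  have inn : ∀ {d : ℕ} (v w : Fin d → ℂ),
      inner ℂ (WithLp.toLp 2 v : EuclideanSpace ℂ (Fin d)) (WithLp.toLp 2 w) = star v ⬝ᵥ w := by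
    intro d v w
    rw [EuclideanSpace.inner_toLp_toLp, dotProduct_comm]
  let A : Fin k → EuclideanSpace ℂ (Fin D) := fun i => WithLp.toLp 2 (a i)
  let B : Fin k → EuclideanSpace ℂ (Fin n) := fun i => WithLp.toLp 2 (b i)
  have hA : ∀ i, A i ≠ 0 := fun i h => H.left_ne i (by simpa [A] using h)
  have hB : ∀ i, B i ≠ 0 := fun i h => H.right_ne i (by simpa [B] using h)
  let A' : Fin k → EuclideanSpace ℂ (Fin D) := fun i => ((‖A i‖⁻¹ : ℝ) : ℂ) • A i
  let B' : Fin k → EuclideanSpace ℂ (Fin n) := fun i => ((‖B i‖⁻¹ : ℝ) : ℂ) • B i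
  have hA' : ∀ i, ‖A' i‖ = 1 := fun i => by
    simp [A', norm_smul, norm_ne_zero_iff.2 (hA i)]
  have hB' : ∀ i, ‖B' i‖ = 1 := fun i => by
    simp [B', norm_smul, norm_ne_zero_iff.2 (hB i)]
  refine ⟨k, fun i => A' i ⊗ₜ[ℂ] B' i, ⟨by omega, fun i => ⟨_, _, hA' i, hB' i, rfl⟩, ?_, ?_⟩, hk⟩
  · refine ⟨fun i => by rw [TensorProduct.norm_tmul, hA', hB', one_mul], fun i j hij => ?_⟩
    change inner ℂ (A' i ⊗ₜ[ℂ] B' i) (A' j ⊗ₜ[ℂ] B' j) = 0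
    rw [TensorProduct.inner_tmul]
    simp only [A', B', A, B, inn]
    rcases H.orth i j hij with h | h <;> simp [h]
  · rintro ψ hψ ⟨x, y, hx, hy, rfl⟩
    have := H.unext x.ofLp y.ofLp fun i => by
      have h := hψ i
      rw [TensorProduct.inner_tmul] at h
      have h1 := norm_ne_zero_iff.2 (hA i)
      have h2 := norm_ne_zero_iff.2 (hB i)
      rw [← inn, ← inn]
      simpa [A', B', inner_smul_left, h1, h2] using h
    rcases this with h | h
    · have : x = 0 := by simpa using congrArg (WithLp.toLp 2) h
      simp [this] at hx
    · have : y = 0 := by simpa using congrArg (WithLp.toLp 2) h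
      simp [this] at hy

/-! ### Explicit small families -/

/-- Integer entries make conjugation invisible and orthogonality decidable. -/
theorem realizable_of_int {k D n s : ℕ} (A : Fin k → Fin D → ℤ) (B : Fin k → Fin n → ℤ)
    (hA : ∀ i, A i ≠ 0) (hB : ∀ i, B i ≠ 0)
    (horth : ∀ i j, i ≠ j → A i ⬝ᵥ A j = 0 ∨ B i ⬝ᵥ B j = 0)
    (hunext : ∀ (x : Fin D → ℂ) (y : Fin n → ℂ),
      (∀ i, ∑ j, (A i j : ℂ) * x j = 0 ∨ ∑ j, (B i j : ℂ) * y j = 0) → x = 0 ∨ y = 0)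
    (hk : k + s = D * n) : Realizable D n s := by
  have cast_ne : ∀ {d : ℕ} (v : Fin d → ℤ), v ≠ 0 → (fun j => (v j : ℂ)) ≠ 0 := by
    intro d v hv h
    exact hv (funext fun j => by simpa using congrFun h j)
  have cast_dot : ∀ {d : ℕ} (v w : Fin d → ℤ), v ⬝ᵥ w = 0 →
      star (fun j => (v j : ℂ)) ⬝ᵥ (fun j => (w j : ℂ)) = 0 := by
    intro d v w h
    simpa [dotProduct] using congrArg (Int.cast : ℤ → ℂ) h
  exact ⟨k, fun i j => A i j, fun i j => B i j,
    ⟨fun i => cast_ne _ (hA i), fun i => cast_ne _ (hB i),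
      fun i j hij => (horth i j hij).imp (cast_dot _ _) (cast_dot _ _),
      fun x y h => hunext x y fun i => by simpa [dotProduct] using h i⟩, hk⟩

/-- Tile construction, used in all four examples: cut the grid into segments of rows and columns,
take on each an orthogonal basis of the complement of its indicator, keep single cells off the list,
and add the all-ones vector. The missing number is the number of tiles minus one; here there are
four dominoes and the cell `(0, 0)`. -/
theorem realizable_three_three : Realizable 3 3 4 := by
  refine realizable_of_int (k := 5)
    ![![1, -1, 0], ![1, 0, -1], ![0, 1, 0], ![0, 0, 1], ![1, 1, 1]]
    ![![0, 1, 0], ![0, 0, 1], ![1, 0, -1], ![1, -1, 0], ![1, 1, 1]]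
    (by decide) (by decide) (by decide) (fun x y h => ?_) rfl
  simp [Fin.forall_fin_succ, Fin.sum_univ_succ] at h
  have : (x 0 = 0 ∧ x 1 = 0 ∧ x 2 = 0) ∨ (y 0 = 0 ∧ y 1 = 0 ∧ y 2 = 0) := by
    grind
  refine this.imp ?_ ?_
  · rintro ⟨h0, h1, h2⟩
    ext i; fin_cases i <;> assumption
  · rintro ⟨h0, h1, h2⟩
    ext i; fin_cases i <;> assumption

theorem realizable_three_four : Realizable 3 4 5 := by
  refine realizable_of_int (k := 7)
    ![![1, 0, 0], ![1, -1, 0], ![1, 0, -1], ![0, 1, 0], ![0, 1, -1], ![0, 0, 1], ![1, 1, 1]]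
    ![![1, -1, 0, 0], ![0, 0, 1, 0], ![0, 0, 0, 1], ![1, 0, 0, -1], ![0, 1, 0, 0],
      ![1, 0, -1, 0], ![1, 1, 1, 1]]
    (by decide) (by decide) (by decide) (fun x y h => ?_) rfl
  simp [Fin.forall_fin_succ, Fin.sum_univ_succ] at h
  have : (x 0 = 0 ∧ x 1 = 0 ∧ x 2 = 0) ∨ (y 0 = 0 ∧ y 1 = 0 ∧ y 2 = 0 ∧ y 3 = 0) := by
    grind
  refine this.imp ?_ ?_
  · rintro ⟨h0, h1, h2⟩
    ext i; fin_cases i <;> assumption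
  · rintro ⟨h0, h1, h2, h3⟩
    ext i; fin_cases i <;> assumption

theorem realizable_four_four_seven : Realizable 4 4 7 := by
  refine realizable_of_int (k := 9)
    ![![1, 0, 0, 0], ![1, -1, 0, 0], ![1, 0, -1, 0], ![0, 1, 0, 0], ![0, 1, 0, -1],
      ![0, 0, 1, -1], ![0, 0, 1, 0], ![0, 0, 0, 1], ![1, 1, 1, 1]]
    ![![1, -1, 0, 0], ![0, 0, 1, 0], ![0, 0, 0, 1], ![1, 0, 0, -1], ![0, 1, 0, 0], ![1, 0, 0, 0],
      ![0, 1, -1, 0], ![0, 0, 1, -1], ![1, 1, 1, 1]]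
    (by decide) (by decide) (by decide) (fun x y h => ?_) rfl
  simp [Fin.forall_fin_succ, Fin.sum_univ_succ] at h
  have : (x 0 = 0 ∧ x 1 = 0 ∧ x 2 = 0 ∧ x 3 = 0) ∨ (y 0 = 0 ∧ y 1 = 0 ∧ y 2 = 0 ∧ y 3 = 0) := by
    grind
  refine this.imp ?_ ?_
  · rintro ⟨h0, h1, h2, h3⟩
    ext i; fin_cases i <;> assumption
  · rintro ⟨h0, h1, h2, h3⟩
    ext i; fin_cases i <;> assumption

theorem realizable_four_four_six : Realizable 4 4 6 := by
  refine realizable_of_int (k := 10)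
    ![![1, -1, 0, 0], ![1, 0, -1, 0], ![1, -1, 0, 0], ![1, 1, 0, -2], ![0, 1, 0, 0],
      ![0, 0, 1, 0], ![0, 0, 1, 0], ![0, 0, 0, 1], ![0, 0, 0, 1], ![1, 1, 1, 1]]
    ![![0, 1, 0, 0], ![0, 0, 1, 0], ![0, 0, 0, 1], ![0, 0, 0, 1], ![1, 0, -1, 0], ![1, -1, 0, 0],
      ![1, 1, 0, -2], ![1, -1, 0, 0], ![1, 1, -2, 0], ![1, 1, 1, 1]]
    (by decide) (by decide) (by decide) (fun x y h => ?_) rfl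
  simp [Fin.forall_fin_succ, Fin.sum_univ_succ] at h
  have : (x 0 = 0 ∧ x 1 = 0 ∧ x 2 = 0 ∧ x 3 = 0) ∨ (y 0 = 0 ∧ y 1 = 0 ∧ y 2 = 0 ∧ y 3 = 0) := by
    grind
  refine this.imp ?_ ?_
  · rintro ⟨h0, h1, h2, h3⟩
    ext i; fin_cases i <;> assumption
  · rintro ⟨h0, h1, h2, h3⟩
    ext i; fin_cases i <;> assumption

/-! ### Points of the unit circle -/

/-- The point `exp(iπx/h)` of the unit circle. -/
noncomputable def rot (h : ℕ) (x : ℝ) : ℂ := Complex.exp ((Real.pi * x / h : ℝ) * Complex.I)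

theorem rot_add (h : ℕ) (x y : ℝ) : rot h (x + y) = rot h x * rot h y := by
  rw [rot, rot, rot, ← Complex.exp_add]
  congr 1; push_cast; ring

@[simp] theorem rot_zero (h : ℕ) : rot h 0 = 1 := by simp [rot]

theorem rot_ne_zero (h : ℕ) (x : ℝ) : rot h x ≠ 0 := Complex.exp_ne_zero _

theorem rot_neg (h : ℕ) (x : ℝ) : rot h (-x) = (rot h x)⁻¹ := by
  refine eq_inv_of_mul_eq_one_left ?_
  rw [← rot_add]; simp

@[simp] theorem norm_rot (h : ℕ) (x : ℝ) : ‖rot h x‖ = 1 := Complex.norm_exp_ofReal_mul_I _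

theorem conj_rot (h : ℕ) (x : ℝ) : (starRingEnd ℂ) (rot h x) = rot h (-x) := by
  rw [rot_neg, Complex.inv_def]
  simp [Complex.normSq_eq_norm_sq]

theorem rot_pow (h : ℕ) (x : ℝ) (n : ℕ) : rot h x ^ n = rot h (n * x) := by
  rw [rot, rot, ← Complex.exp_nat_mul]
  congr 1; push_cast; ring

theorem rot_re (h : ℕ) (x : ℝ) : (rot h x).re = Real.cos (Real.pi * x / h) :=
  Complex.exp_ofReal_mul_I_re _

theorem rot_im (h : ℕ) (x : ℝ) : (rot h x).im = Real.sin (Real.pi * x / h) :=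
  Complex.exp_ofReal_mul_I_im _

theorem rot_sub_rot (h : ℕ) (x y : ℝ) :
    rot h x - rot h y = 2 * Complex.I * Real.sin (Real.pi * ((x - y) / 2) / h) *
      rot h ((x + y) / 2) := by
  have hx : rot h x = rot h ((x + y) / 2) * rot h ((x - y) / 2) := by
    rw [← rot_add]; congr 1; ring
  have hy : rot h y = rot h ((x + y) / 2) * rot h (-((x - y) / 2)) := by
    rw [← rot_add]; congr 1; ring
  have key : rot h ((x - y) / 2) - rot h (-((x - y) / 2)) =
      2 * Complex.I * Real.sin (Real.pi * ((x - y) / 2) / h) := by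
    rw [← conj_rot, Complex.sub_conj, rot_im]
    push_cast; ring
  rw [hx, hy, ← mul_sub, key]; ring

theorem rot_eq_one_iff {h : ℕ} (hh : h ≠ 0) (x : ℝ) : rot h x = 1 ↔ ∃ n : ℤ, x = 2 * h * n := by
  have h0 : (h : ℝ) ≠ 0 := Nat.cast_ne_zero.2 hh
  rw [rot, Complex.exp_eq_one_iff]
  refine exists_congr fun n => ?_
  have : (n : ℂ) * (2 * Real.pi * Complex.I) = ((n * (2 * Real.pi) : ℝ) : ℂ) * Complex.I := by
    push_cast; ring
  rw [this, mul_left_inj' Complex.I_ne_zero, Complex.ofReal_inj, div_eq_iff h0]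
  constructor
  · intro H
    have : Real.pi * x = Real.pi * (2 * h * n) := by rw [H]; ring
    exact mul_left_cancel₀ Real.pi_ne_zero this
  · rintro rfl; ring

theorem rot_two_mul_int {h : ℕ} (hh : h ≠ 0) (n : ℤ) : rot h (2 * h * n) = 1 :=
  (rot_eq_one_iff hh _).2 ⟨n, rfl⟩

theorem rot_self {h : ℕ} (hh : h ≠ 0) : rot h h = -1 := by
  have h0 : (h : ℝ) ≠ 0 := Nat.cast_ne_zero.2 hh
  rw [rot, mul_div_assoc, div_self h0, mul_one, Complex.exp_pi_mul_I]

theorem rot_eq_rot_iff {h : ℕ} (hh : h ≠ 0) (x y : ℝ) :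
    rot h x = rot h y ↔ ∃ n : ℤ, x - y = 2 * h * n := by
  rw [← rot_eq_one_iff hh, sub_eq_add_neg, rot_add, rot_neg, mul_inv_eq_one₀ (rot_ne_zero h y)]

theorem sum_rot_eq_zero {h : ℕ} (hh : h ≠ 0) {d : ℤ} (hd : ¬ (h : ℤ) ∣ d) :
    ∑ r ∈ Finset.range h, rot h (r * (2 * d)) = 0 := by
  have hne : rot h (2 * d) ≠ 1 := by
    rw [Ne, rot_eq_one_iff hh]
    rintro ⟨n, hn⟩
    refine hd ⟨n, ?_⟩
    have : (d : ℝ) = (h * n : ℤ) := by push_cast; linarith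
    exact_mod_cast this
  have := geom_sum_eq hne h
  simp only [rot_pow] at this
  rw [this, show (h : ℝ) * (2 * d) = 2 * h * d by ring, rot_two_mul_int hh]
  simp

theorem sin_pi_mul_div_pos {h : ℕ} {x : ℝ} (hx : 0 < x) (hxh : x < h) :
    0 < Real.sin (Real.pi * x / h) := by
  have h0 : (0 : ℝ) < h := hx.trans hxh
  refine Real.sin_pos_of_pos_of_lt_pi (by positivity) ?_
  rw [div_lt_iff₀ h0]
  exact mul_lt_mul_of_pos_left hxh Real.pi_pos

/-! ### Gaussian binomials and the roots of their generating polynomial -/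

/-- The Gaussian binomial coefficients of `e` at `exp(2πi/h)`, normalised to be real. -/
noncomputable def sineBinom (h e k : ℕ) : ℝ :=
  ∏ i ∈ Finset.range k, Real.sin (Real.pi * (e - i) / h) / Real.sin (Real.pi * (i + 1) / h)

theorem sineBinom_pos {h e k : ℕ} (heh : e < h) (hk : k ≤ e) : 0 < sineBinom h e k := by
  refine Finset.prod_pos fun i hi => ?_
  have hi : i < k := Finset.mem_range.1 hi
  have h1 : (i : ℝ) + 1 ≤ e := by exact_mod_cast hi.trans_le hk
  have h2 : (e : ℝ) < h := by exact_mod_cast heh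
  have h3 : (0 : ℝ) ≤ i := i.cast_nonneg
  exact div_pos (sin_pi_mul_div_pos (by linarith) (by linarith))
    (sin_pi_mul_div_pos (by linarith) (by linarith))

theorem sineBinom_succ {h e k : ℕ} (hk : k + 1 < h) :
    sineBinom h e (k + 1) * Real.sin (Real.pi * (k + 1) / h) =
      sineBinom h e k * Real.sin (Real.pi * (e - k) / h) := by
  have h2 : (k : ℝ) + 1 < h := by exact_mod_cast hk
  have h3 : (0 : ℝ) ≤ k := k.cast_nonneg
  have := (sin_pi_mul_div_pos (h := h) (x := k + 1) (by linarith) h2).ne'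
  rw [sineBinom, Finset.prod_range_succ, ← sineBinom]
  field_simp

/-- The generating polynomial of `sineBinom`. -/
noncomputable def sinePoly (h e : ℕ) (z : ℂ) : ℂ :=
  ∑ k ∈ Finset.range (e + 1), (sineBinom h e k : ℂ) * z ^ k

/-- The q-difference equation behind the q-binomial theorem; coefficientwise it is the recursion
`sineBinom_succ`. -/
theorem sinePoly_rot_mul {h e : ℕ} (heh : e < h) (z : ℂ) :
    (1 + rot h (-e) * z) * sinePoly h e (rot h 1 * z) =
      (1 + rot h e * z) * sinePoly h e (rot h (-1) * z) := by
  have key : ∀ x : ℝ, rot h x - rot h (-x) = 2 * Complex.I * Real.sin (Real.pi * x / h) := by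
    intro x; rw [rot_sub_rot]; simp
  have e1 : sinePoly h e (rot h 1 * z) - sinePoly h e (rot h (-1) * z) =
      ∑ k ∈ Finset.range (e + 1),
        2 * Complex.I * ((sineBinom h e k * Real.sin (Real.pi * k / h) : ℝ) : ℂ) * z ^ k := by
    rw [sinePoly, sinePoly, ← Finset.sum_sub_distrib]
    refine Finset.sum_congr rfl fun k _ => ?_
    have := key k
    rw [mul_pow, mul_pow, rot_pow, rot_pow, mul_one, mul_neg_one]
    rw [Complex.ofReal_mul]
    linear_combination (sineBinom h e k : ℂ) * z ^ k * this
  have e2 : rot h e * sinePoly h e (rot h (-1) * z) - rot h (-e) * sinePoly h e (rot h 1 * z) =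
      ∑ k ∈ Finset.range (e + 1),
        2 * Complex.I * ((sineBinom h e k * Real.sin (Real.pi * (e - k) / h) : ℝ) : ℂ) * z ^ k := by
    rw [sinePoly, sinePoly, Finset.mul_sum, Finset.mul_sum, ← Finset.sum_sub_distrib]
    refine Finset.sum_congr rfl fun k _ => ?_
    have := key (e - k)
    rw [neg_sub, sub_eq_add_neg (e : ℝ), rot_add, sub_eq_add_neg (k : ℝ), rot_add,
      ← sub_eq_add_neg (e : ℝ)] at this
    rw [mul_pow, mul_pow, rot_pow, rot_pow, mul_one, mul_neg_one, Complex.ofReal_mul]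
    linear_combination (sineBinom h e k : ℂ) * z ^ k * this
  rw [Finset.sum_range_succ'] at e1
  rw [Finset.sum_range_succ] at e2
  simp only [CharP.cast_eq_zero, mul_zero, zero_div, Real.sin_zero, Complex.ofReal_zero,
    pow_zero, zero_mul, add_zero, sub_self] at e1 e2
  have e3 : sinePoly h e (rot h 1 * z) - sinePoly h e (rot h (-1) * z) =
      z * (rot h e * sinePoly h e (rot h (-1) * z) -
        rot h (-e) * sinePoly h e (rot h 1 * z)) := by
    rw [e1, e2, Finset.mul_sum]
    refine Finset.sum_congr rfl fun k hk => ?_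
    have hk := Finset.mem_range.1 hk
    rw [← sineBinom_succ (by omega), pow_succ]
    push_cast; ring
  linear_combination e3

/-- In `sinePoly_rot_mul` the factor `1 + rot h e * z` vanishes at `z = -rot h (-e)`, giving the
first root. The equation then carries each root to the next, two steps further round, until the
other factor vanishes. -/
theorem sinePoly_root {h e : ℕ} (heh : e < h) {l : ℕ} (hl : l < e) :
    sinePoly h e (-rot h (1 - e + 2 * l)) = 0 := by
  have hh : h ≠ 0 := by omega
  have aux : ∀ x : ℝ, -(2 * h : ℝ) < x → x < 0 → 1 - rot h x ≠ 0 := by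
    intro x hx0 hx1 H
    obtain ⟨n, hn⟩ := (rot_eq_one_iff hh x).1 (sub_eq_zero.1 H).symm
    have hpos : (0 : ℝ) < 2 * h := by positivity
    have h1 : (n : ℝ) < 0 := by nlinarith
    have h2 : (-1 : ℝ) < n := by nlinarith
    have h1' : n < 0 := by exact_mod_cast h1
    have h2' : -1 < n := by exact_mod_cast h2
    omega
  have heh' : (e : ℝ) < h := by exact_mod_cast heh
  induction l with
  | zero =>
    have := sinePoly_rot_mul heh (-rot h (-e))
    rw [mul_neg, mul_neg, mul_neg, mul_neg, ← rot_add, ← rot_add, ← rot_add, ← rot_add] at this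
    simp only [add_neg_cancel, rot_zero, zero_mul] at this
    have hne := aux (-e + -e) (by linarith) (by
      have : (0 : ℝ) < e := by exact_mod_cast hl
      linarith)
    rw [← sub_eq_add_neg] at this
    have := (mul_eq_zero.1 this).resolve_left hne
    rw [← this]; congr 3; push_cast; ring
  | succ l ih =>
    have ih := ih (by omega)
    have := sinePoly_rot_mul heh (-rot h (1 - e + 2 * l + 1))
    rw [mul_neg, mul_neg, mul_neg, mul_neg, ← rot_add, ← rot_add, ← rot_add, ← rot_add] at this
    rw [show (-1 : ℝ) + (1 - e + 2 * l + 1) = 1 - e + 2 * l by ring, ih, mul_zero,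
      ← sub_eq_add_neg] at this
    have hl' : (l : ℝ) + 2 ≤ e := by exact_mod_cast hl
    have hl0 : (0 : ℝ) ≤ l := l.cast_nonneg
    have := (mul_eq_zero.1 this).resolve_left (aux _ (by linarith) (by linarith))
    rw [← this]; congr 3; push_cast; ring

/-! ### A convexity criterion for staying in the unit disc -/

/-- A discrete maximum principle. -/
theorem neg_of_second_difference {m s : ℕ → ℝ} {κ : ℝ} {n : ℕ} (h0 : m 0 < 0) (hn : m n ≤ 0)
    (hs : ∀ j ≤ n, 0 < s j)
    (hsrec : ∀ j, j + 2 ≤ n → s (j + 2) + s j = 2 * κ * s (j + 1))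
    (hm : ∀ j, j + 2 ≤ n → 2 * κ * m (j + 1) ≤ m (j + 2) + m j) :
    ∀ j < n, m j < 0 := by
  by_contra! H
  have hex : ∃ j, j < n ∧ 0 ≤ m j := H
  classical
  obtain ⟨hjn, hj⟩ := Nat.find_spec hex
  have hmin := fun i => Nat.find_min hex (m := i)
  set j := Nat.find hex
  have hj0 : j ≠ 0 := fun h => by rw [h] at hj; linarith
  obtain ⟨i, hi⟩ := Nat.exists_eq_succ_of_ne_zero hj0
  have hi' : m i < 0 := by
    by_contra! h
    exact hmin i (by omega) ⟨by omega, h⟩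
  -- Sturm comparison with the positive solution `s`: once `m` has turned nonnegative, the discrete
  -- Wronskian stays positive, so `m / s` keeps increasing and `m n` would be positive.
  have step : ∀ k, i + 1 + k < n →
      0 < m (i + 1 + k) * s (i + k) - m (i + k) * s (i + 1 + k) ∧ 0 ≤ m (i + 1 + k) := by
    intro k
    induction k with
    | zero =>
      intro hk
      rw [hi] at hj
      refine ⟨?_, hj⟩
      have := mul_nonneg hj (hs i (by omega)).le
      have := mul_neg_of_neg_of_pos hi' (hs (i + 1) (by omega))
      simp only [add_zero]; linarith
    | succ k ih =>
      intro hk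
      obtain ⟨h1, h2⟩ := ih (by omega)
      have hs1 := hs (i + 1 + k) (by omega)
      have hs2 := hs (i + 1 + (k + 1)) (by omega)
      have r1 := hsrec (i + k) (by omega)
      have r2 := hm (i + k) (by omega)
      rw [show i + k + 2 = i + 1 + (k + 1) by ring, show i + k + 1 = i + 1 + k by ring] at r1 r2
      rw [show i + (k + 1) = i + 1 + k by ring]
      have h3 : 0 < m (i + 1 + (k + 1)) * s (i + 1 + k) - m (i + 1 + k) * s (i + 1 + (k + 1)) := by
        nlinarith [mul_le_mul_of_nonneg_right r2 hs1.le]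
      refine ⟨h3, ?_⟩
      have h4 : 0 < m (i + 1 + (k + 1)) * s (i + 1 + k) := by
        have := mul_nonneg h2 hs2.le
        linarith
      exact (pos_of_mul_pos_left h4 hs1.le).le
  obtain ⟨h1, h2⟩ := step (n - 2 - i) (by omega)
  have hs1 := hs (n - 1) (by omega)
  have hs2 := hs n le_rfl
  have r1 := hsrec (n - 2) (by omega)
  have r2 := hm (n - 2) (by omega)
  rw [show i + 1 + (n - 2 - i) = n - 1 by omega, show i + (n - 2 - i) = n - 2 by omega] at h1
  rw [show i + 1 + (n - 2 - i) = n - 1 by omega] at h2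
  rw [show n - 2 + 2 = n by omega, show n - 2 + 1 = n - 1 by omega] at r1 r2
  have h3 : 0 < m n * s (n - 1) - m (n - 1) * s n := by
    nlinarith [mul_le_mul_of_nonneg_right r2 hs1.le]
  have h4 := mul_nonneg h2 hs2.le
  have h5 := mul_nonpos_of_nonpos_of_nonneg hn hs1.le
  linarith

/-- The product `∏_{l < N} sin(π(r - l)/h)`. -/
noncomputable def sineProd (h N r : ℕ) : ℝ :=
  ∏ l ∈ Finset.range N, Real.sin (Real.pi * (r - l) / h)

theorem sineProd_eq_zero {h N r : ℕ} (hr : r < N) : sineProd h N r = 0 :=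
  Finset.prod_eq_zero (Finset.mem_range.2 hr) (by simp)

theorem sineProd_pos {h N r : ℕ} (hNr : N ≤ r) (hr : r < h) : 0 < sineProd h N r := by
  refine Finset.prod_pos fun l hl => ?_
  have h1 : (l : ℝ) + 1 ≤ r := by exact_mod_cast (Finset.mem_range.1 hl).trans_le hNr
  have h2 : (r : ℝ) < h := by exact_mod_cast hr
  have h3 : (0 : ℝ) ≤ l := l.cast_nonneg
  exact sin_pi_mul_div_pos (by linarith) (by linarith)

theorem sineProd_succ (h N r : ℕ) :
    sineProd h N (r + 1) * Real.sin (Real.pi * (r + 1 - N) / h) =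
      sineProd h N r * Real.sin (Real.pi * (r + 1) / h) := by
  have h1 := Finset.prod_range_succ (fun l : ℕ => Real.sin (Real.pi * (r + 1 - l) / h)) N
  rw [Finset.prod_range_succ'] at h1
  simp only [sineProd]
  push_cast at h1 ⊢
  rw [← h1]
  simp only [sub_zero, add_sub_add_right_eq_sub]

/-- By `sineProd_succ` the ratio of consecutive terms is a quotient of two sines, at least `1` as
long as their mean angle is at most `π / 2`. -/
theorem sineProd_le_succ {h N r : ℕ} (hr : 2 * r + 2 ≤ N + h) (hrh : r + 1 < h) :
    sineProd h N r ≤ sineProd h N (r + 1) := by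
  rcases lt_or_ge r N with hrN | hrN
  · rw [sineProd_eq_zero hrN]
    rcases lt_or_ge (r + 1) N with h1 | h1
    · rw [sineProd_eq_zero h1]
    · exact (sineProd_pos h1 hrh).le
  have h0 : (0 : ℝ) < h := by exact_mod_cast (by omega : 0 < h)
  have e1 : (r : ℝ) + 1 < h := by exact_mod_cast hrh
  have e2 : (N : ℝ) ≤ r := by exact_mod_cast hrN
  have e3 : 2 * (r : ℝ) + 2 ≤ N + h := by exact_mod_cast hr
  have e4 : (0 : ℝ) ≤ N := N.cast_nonneg
  have hs1 := sin_pi_mul_div_pos (h := h) (x := r + 1 - N) (by linarith) (by linarith)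
  have hle : Real.sin (Real.pi * (r + 1 - N) / h) ≤ Real.sin (Real.pi * (r + 1) / h) := by
    rw [← sub_nonneg, Real.sin_sub_sin]
    refine mul_nonneg (mul_nonneg zero_le_two (Real.sin_nonneg_of_nonneg_of_le_pi ?_ ?_))
      (Real.cos_nonneg_of_neg_pi_div_two_le_of_le ?_ ?_)
    · rw [← sub_div, ← mul_sub]
      have : (0 : ℝ) ≤ (r : ℝ) + 1 - (r + 1 - N) := by linarith
      have := Real.pi_pos
      positivity
    · rw [← sub_div, ← mul_sub, div_div, div_le_iff₀ (by positivity)]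
      exact mul_le_mul_of_nonneg_left (by linarith) Real.pi_pos.le
    · have : (0 : ℝ) ≤ (r : ℝ) + 1 + (r + 1 - N) := by linarith
      have := Real.pi_pos
      rw [← add_div, ← mul_add]
      have : 0 ≤ Real.pi * ((r : ℝ) + 1 + (r + 1 - N)) / h / 2 := by positivity
      linarith
    · rw [← add_div, ← mul_add, div_div, div_le_div_iff₀ (by positivity) (by positivity)]
      have := mul_le_mul_of_nonneg_left (a := Real.pi) (show (r : ℝ) + 1 + (r + 1 - N) ≤ h by linarith)
        Real.pi_pos.le
      linarith
  have hW := (sineProd_pos hrN (by omega : r < h)).le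
  have := sineProd_succ h N r
  have : sineProd h N r * Real.sin (Real.pi * (r + 1 - N) / h) ≤
      sineProd h N (r + 1) * Real.sin (Real.pi * (r + 1 - N) / h) := by
    rw [this]; exact mul_le_mul_of_nonneg_left hle hW
  exact le_of_mul_le_mul_right this hs1

/-- A polygon starting at `1` whose edges turn slowly, with edge lengths increasing up to its axis
of symmetry, stays inside the unit disc. -/
theorem norm_lt_one_of_increments {h N : ℕ} (hN : 1 ≤ N) (hNh : N + 3 ≤ h)
    (hpar : (N + h) % 2 = 1) {g : ℕ → ℂ} {K : ℂ} {δ : ℝ} (hδ0 : 0 ≤ δ) (hδ : δ ≤ 1 / 4)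
    (hinc : ∀ r, g (r + 1) - g r = K * rot h (2 * δ * r) * sineProd h N r)
    (hg1 : ∀ r ≤ N, g r = 1) (hsymm : ∀ r ≤ N + h, ‖g (N + h - r)‖ = ‖g r‖)
    (hK : (K * rot h (2 * δ * (N - 1))).re < 0) :
    ∀ r, N < r → r < h → ‖g r‖ < 1 := by
  have hh0 : (0 : ℝ) < h := by exact_mod_cast (by omega : 0 < h)
  -- By parity the reflection `r ↦ N + h - r` exchanges `c` and `c + 1`, so the middle edge joins
  -- two points of equal norm.
  obtain ⟨c, hc⟩ : ∃ c, N + h = 2 * c + 1 := ⟨(N + h) / 2, by omega⟩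
  -- Up to the factor `sineProd h N r`, this is the increment of the squared norm. The goal is `m <
  -- 0` from `N - 1` up to the axis `c`, where `m` vanishes.
  set m : ℕ → ℝ := fun r =>
    ((g r + g (r + 1)) * ((starRingEnd ℂ) K * rot h (-(2 * δ * r)))).re with hm
  have hnorm : ∀ r, ‖g (r + 1)‖ ^ 2 - ‖g r‖ ^ 2 = sineProd h N r * m r := by
    intro r
    have e1 : ‖g (r + 1)‖ ^ 2 - ‖g r‖ ^ 2 =
        ((g r + g (r + 1)) * (starRingEnd ℂ) (g (r + 1) - g r)).re := by
      rw [← Complex.normSq_eq_norm_sq, ← Complex.normSq_eq_norm_sq, Complex.normSq_apply,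
        Complex.normSq_apply]
      simp only [map_sub, Complex.mul_re, Complex.add_re, Complex.sub_re, Complex.add_im,
        Complex.sub_im, Complex.conj_re, Complex.conj_im]
      ring
    rw [e1, hinc, hm]
    simp only [map_mul, conj_rot, Complex.conj_ofReal]
    rw [← mul_assoc, Complex.re_mul_ofReal, mul_comm]
  have hrec : ∀ r, m (r + 2) + m r - 2 * Real.cos (Real.pi * (2 * δ) / h) * m (r + 1) =
      Complex.normSq K * (sineProd h N (r + 2) - sineProd h N r) := by
    intro r
    have i0 := hinc r
    have i1 := hinc (r + 1)
    have i2 := hinc (r + 2)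
    set u := rot h (2 * δ * r) with hu
    set v := rot h (2 * δ) with hv
    set u' := rot h (-(2 * δ * r)) with hu'
    set v' := rot h (-(2 * δ)) with hv'
    have huu : u * u' = 1 := by rw [hu, hu', ← rot_add]; simp
    have hvv : v * v' = 1 := by rw [hv, hv', ← rot_add]; simp
    have r1 : rot h (2 * δ * ((r + 1 : ℕ) : ℝ)) = u * v := by
      rw [hu, hv, ← rot_add]; congr 1; push_cast; ring
    have r2 : rot h (2 * δ * ((r + 2 : ℕ) : ℝ)) = u * v * v := by
      rw [hu, hv, ← rot_add, ← rot_add]; congr 1; push_cast; ring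
    have r1' : rot h (-(2 * δ * ((r + 1 : ℕ) : ℝ))) = u' * v' := by
      rw [hu', hv', ← rot_add]; congr 1; push_cast; ring
    have r2' : rot h (-(2 * δ * ((r + 2 : ℕ) : ℝ))) = u' * v' * v' := by
      rw [hu', hv', ← rot_add, ← rot_add]; congr 1; push_cast; ring
    have hcos : ((2 * Real.cos (Real.pi * (2 * δ) / h) : ℝ) : ℂ) = v + v' := by
      rw [hv, hv', ← conj_rot, Complex.add_conj, rot_re]
    have hvim : (v - v').re = 0 := by
      rw [hv, hv', ← conj_rot, Complex.sub_conj]; simp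
    rw [r1] at i1
    rw [r2] at i2
    have key : (g (r + 2) + g (r + 3)) * ((starRingEnd ℂ) K * (u' * v' * v')) +
        (g r + g (r + 1)) * ((starRingEnd ℂ) K * u') -
        (v + v') * ((g (r + 1) + g (r + 2)) * ((starRingEnd ℂ) K * (u' * v'))) =
        ((Complex.normSq K * (sineProd h N (r + 2) - sineProd h N r) : ℝ) : ℂ) -
          ((Complex.normSq K * sineProd h N (r + 1) : ℝ) : ℂ) * (v - v') := by
      have e3 : g (r + 3) = g (r + 2) + K * (u * v * v) * sineProd h N (r + 2) := by
        rw [← i2]; ring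
      have e2 : g (r + 2) = g (r + 1) + K * (u * v) * sineProd h N (r + 1) := by
        rw [← i1]; ring
      have e1 : g (r + 1) = g r + K * u * sineProd h N r := by
        rw [← i0]; ring
      rw [e3, e2, e1]
      push_cast
      rw [Complex.normSq_eq_conj_mul_self]
      have huv : u * u' * (v * v') = 1 := by rw [huu, hvv, one_mul]
      have e4 : u * u' * (v * v') * (v * v') = 1 := by rw [huu, hvv]; ring
      have hvi : v' = v⁻¹ := by rw [hv', hv, rot_neg]
      have hui : u' = u⁻¹ := by rw [hu', hu, rot_neg]
      have hv0 : v ≠ 0 := rot_ne_zero _ _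
      have hu0 : u ≠ 0 := rot_ne_zero _ _
      rw [hvi, hui]
      field_simp
      ring
    have := congrArg Complex.re key
    rw [← hcos] at this
    simp only [Complex.sub_re, Complex.add_re, Complex.re_ofReal_mul, Complex.ofReal_re] at this
    rw [← Complex.sub_re, hvim] at this
    simp only [hm]
    rw [r1', r2']
    linarith
  have hcsymm : ‖g (c + 1)‖ = ‖g c‖ := by
    rw [← hsymm c (by omega)]; congr 2; omega
  have hmc : m c = 0 := by
    have := hnorm c
    rw [hcsymm, sub_self] at this
    exact (mul_eq_zero.1 this.symm).resolve_left (sineProd_pos (by omega) (by omega)).ne'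
  have hm0 : m (N - 1) < 0 := by
    simp only [hm]
    rw [hg1 _ (by omega), hg1 _ (by omega), Nat.cast_sub hN, ← conj_rot, ← map_mul]
    have : ((1 : ℂ) + 1) = ((2 : ℝ) : ℂ) := by norm_num
    rw [this, Complex.re_ofReal_mul, Complex.conj_re]
    push_cast; linarith
  obtain ⟨n, hn⟩ : ∃ n, c = N - 1 + n := ⟨c - (N - 1), by omega⟩
  have hneg : ∀ j < n, m (N - 1 + j) < 0 := by
    -- The comparison solution is the cosine centred at the axis; `δ ≤ 1 / 4` keeps its argument
    -- below `π / 2`.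
    refine neg_of_second_difference (m := fun j => m (N - 1 + j))
      (s := fun j => Real.cos (Real.pi * (2 * δ * (n - j)) / h))
      (κ := Real.cos (Real.pi * (2 * δ) / h)) (by simpa using hm0) (by simp [← hn, hmc]) ?_ ?_ ?_
    · intro j hj
      have h1 : (j : ℝ) ≤ n := by exact_mod_cast hj
      have h2 : (n : ℝ) < h := by exact_mod_cast (by omega : n < h)
      have h3 : (0 : ℝ) ≤ j := j.cast_nonneg
      have h4 : 2 * δ * (n - j) ≤ 1 / 2 * (n - j) :=
        mul_le_mul_of_nonneg_right (by linarith) (by linarith)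
      have h5 : 0 ≤ 2 * δ * ((n : ℝ) - j) := mul_nonneg (by linarith) (by linarith)
      have hpi := Real.pi_pos
      refine Real.cos_pos_of_mem_Ioo ⟨?_, ?_⟩
      · have : 0 ≤ Real.pi * (2 * δ * ((n : ℝ) - j)) / h := by positivity
        linarith
      · rw [div_lt_iff₀ hh0]
        have := mul_lt_mul_of_pos_left (show 2 * δ * ((n : ℝ) - j) < h / 2 by linarith) hpi
        linarith
    · intro j hj
      have e0 : Real.pi * (2 * δ * ((n : ℝ) - j)) / h =
          Real.pi * (2 * δ * (n - (j + 1 : ℕ))) / h + Real.pi * (2 * δ) / h := by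
        push_cast; field_simp; ring
      have e2 : Real.pi * (2 * δ * ((n : ℝ) - (j + 2 : ℕ))) / h =
          Real.pi * (2 * δ * (n - (j + 1 : ℕ))) / h - Real.pi * (2 * δ) / h := by
        push_cast; field_simp; ring
      simp only [e0, e2, Real.cos_add, Real.cos_sub]
      ring
    · intro j hj
      have := hrec (N - 1 + j)
      have h1 : sineProd h N (N - 1 + j) ≤ sineProd h N (N - 1 + j + 1) :=
        sineProd_le_succ (by omega) (by omega)
      have h2 : sineProd h N (N - 1 + j + 1) ≤ sineProd h N (N - 1 + j + 2) :=
        sineProd_le_succ (by omega) (by omega)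
      have := mul_nonneg (Complex.normSq_nonneg K) (sub_nonneg.2 (h1.trans h2))
      show 2 * _ * m (N - 1 + j + 1) ≤ m (N - 1 + j + 2) + m (N - 1 + j)
      linarith
  have hlow : ∀ k, N + 1 + k ≤ c → ‖g (N + 1 + k)‖ < 1 := by
    have step : ∀ r, N ≤ r → r < c → ‖g (r + 1)‖ < ‖g r‖ := by
      intro r h1 h2
      have h3 := hneg (r - (N - 1)) (by omega)
      rw [show N - 1 + (r - (N - 1)) = r by omega] at h3
      have h4 := mul_neg_of_pos_of_neg (sineProd_pos h1 (by omega : r < h)) h3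
      rw [← hnorm] at h4
      exact lt_of_pow_lt_pow_left₀ 2 (norm_nonneg _) (by linarith)
    intro k
    induction k with
    | zero =>
      intro hk
      have := step N le_rfl (by omega)
      rwa [hg1 N le_rfl, norm_one] at this
    | succ k ih =>
      intro hk
      exact (step (N + 1 + k) (by omega) (by omega)).trans (ih (by omega))
  intro r hr1 hr2
  rcases le_or_gt r c with h1 | h1
  · have := hlow (r - (N + 1)) (by omega)
    rwa [show N + 1 + (r - (N + 1)) = r by omega] at this
  · rw [← hsymm r (by omega)]
    have := hlow (N + h - r - (N + 1)) (by omega)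
    rwa [show N + 1 + (N + h - r - (N + 1)) = N + h - r by omega] at this

/-! ### The interpolation multiplier and its modulus -/

/-- Interpolation nodes on the unit circle, in geometric progression. -/
noncomputable def node (h N t : ℕ) : ℂ := rot h (2 * (t - N / 2 + 1 / 4))

/-- The Lagrange weights for evaluation at `1` from the values at the nodes. -/
noncomputable def weight (h N t : ℕ) : ℂ :=
  ∏ s ∈ (Finset.range (N + 1)).erase t, (1 - node h N s) / (node h N t - node h N s)

/-- The value at `1` of the interpolation polynomial of `z ^ r`. -/
noncomputable def symbol (h N r : ℕ) : ℂ :=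
  ∑ t ∈ Finset.range (N + 1), weight h N t * node h N t ^ r

theorem node_ne_zero (h N t : ℕ) : node h N t ≠ 0 := rot_ne_zero _ _

theorem node_eq (h N t : ℕ) : node h N t = node h N 0 * rot h 2 ^ t := by
  rw [node, node, rot_pow, ← rot_add]; congr 1; push_cast; ring

theorem rot_two_pow_injOn {h : ℕ} (hh : h ≠ 0) {s t : ℕ} (hs : s < h) (ht : t < h)
    (hst : rot h 2 ^ s = rot h 2 ^ t) : s = t := by
  rw [rot_pow, rot_pow, rot_eq_rot_iff hh] at hst
  obtain ⟨n, hn⟩ := hst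
  have h1 : (s : ℤ) - t = h * n := by
    have : (s : ℝ) - t = h * n := by linarith
    exact_mod_cast this
  have h2 : (h : ℤ) ∣ (s : ℤ) - t := ⟨n, h1⟩
  have := Int.eq_zero_of_abs_lt_dvd h2 (by rw [abs_lt]; omega)
  omega

theorem node_injOn {h N : ℕ} (hN : N < h) :
    Set.InjOn (node h N) (Finset.range (N + 1) : Set ℕ) := by
  intro s hs t ht hst
  have hs := Finset.mem_range.1 hs
  have ht := Finset.mem_range.1 ht
  rw [node_eq, node_eq h N t] at hst
  exact rot_two_pow_injOn (by omega) (by omega) (by omega)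
    (mul_left_cancel₀ (node_ne_zero h N 0) hst)

/-- Interpolation at `N + 1` nodes is exact in degree at most `N`. -/
theorem symbol_eq_one {h N r : ℕ} (hN : N < h) (hr : r ≤ N) : symbol h N r = 1 := by
  open Polynomial in
  have H := Lagrange.eq_interpolate (s := Finset.range (N + 1)) (v := node h N)
    (f := (X ^ r : ℂ[X])) (node_injOn hN) (by
      rw [Polynomial.degree_X_pow, Finset.card_range]
      exact_mod_cast Nat.lt_succ_of_le hr)
  have := congrArg (Polynomial.eval 1) H
  rw [Lagrange.interpolate_apply, Polynomial.eval_finsetSum] at this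
  simp only [Polynomial.eval_pow, Polynomial.eval_X, one_pow, Polynomial.eval_mul,
    Polynomial.eval_C, Lagrange.basis, Lagrange.basisDivisor, Polynomial.eval_prod,
    Polynomial.eval_sub] at this
  rw [this, symbol]
  refine Finset.sum_congr rfl fun t _ => ?_
  rw [mul_comm, weight]
  congr 1
  exact Finset.prod_congr rfl fun s _ => by rw [div_eq_inv_mul]

/-- The increment is `node h N 0 ^ r` times a polynomial of degree at most `N` in `rot h 2 ^ r`. It
vanishes for `r < N` by `symbol_eq_one`, so all its roots are known and only the leading coefficient
remains. -/
theorem symbol_succ_sub {h N : ℕ} (hN : N < h) (r : ℕ) :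
    symbol h N (r + 1) - symbol h N r =
      weight h N N * (node h N N - 1) * node h N 0 ^ r *
        ∏ l ∈ Finset.range N, (rot h 2 ^ r - rot h 2 ^ l) := by
  open Polynomial in
  set P : ℂ[X] := ∑ t ∈ Finset.range (N + 1), C (weight h N t * (node h N t - 1)) * X ^ t with hP
  have hinc : ∀ r, symbol h N (r + 1) - symbol h N r =
      node h N 0 ^ r * P.eval (rot h 2 ^ r) := by
    intro r
    rw [symbol, symbol, ← Finset.sum_sub_distrib, hP, Polynomial.eval_finsetSum, Finset.mul_sum]
    refine Finset.sum_congr rfl fun t _ => ?_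
    have : node h N t ^ r = node h N 0 ^ r * (rot h 2 ^ r) ^ t := by
      rw [node_eq, mul_pow]; ring
    simp only [Polynomial.eval_mul, Polynomial.eval_C, Polynomial.eval_pow, Polynomial.eval_X]
    rw [pow_succ, this]; ring
  open Polynomial in
  set Q : ℂ[X] := C (weight h N N * (node h N N - 1)) *
    ∏ l ∈ Finset.range N, (X - C (rot h 2 ^ l)) with hQ
  have hPQ : P = Q := by
    have hmonic : (∏ l ∈ Finset.range N, (Polynomial.X - Polynomial.C (rot h 2 ^ l))).Monic :=
      Polynomial.monic_prod_X_sub_C _ _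
    have hdeg : (∏ l ∈ Finset.range N, (Polynomial.X - Polynomial.C (rot h 2 ^ l))).natDegree
        = N := by
      rw [Polynomial.natDegree_prod_of_monic _ _ fun l _ => Polynomial.monic_X_sub_C _]
      simp only [Polynomial.natDegree_X_sub_C]
      simp
    rw [← sub_eq_zero]
    refine Polynomial.eq_zero_of_degree_lt_of_eval_finset_eq_zero
      ((Finset.range N).image fun l => rot h 2 ^ l) ?_ ?_
    · rw [Finset.card_image_of_injOn fun s hs t ht hst => rot_two_pow_injOn (by omega)
        ((Finset.mem_range.1 hs).trans hN) ((Finset.mem_range.1 ht).trans hN) hst,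
        Finset.card_range, Polynomial.degree_lt_iff_coeff_zero]
      intro k hk
      have h1 : P.coeff k = if k = N then weight h N N * (node h N N - 1) else 0 := by
        rw [hP, Polynomial.finsetSum_coeff]
        simp only [Polynomial.coeff_C_mul_X_pow]
        rw [Finset.sum_ite_eq]
        by_cases hkN : k = N
        · simp [hkN]
        · rw [if_neg hkN, if_neg]
          rw [Finset.mem_range]; omega
      rw [Polynomial.coeff_sub, h1, hQ, Polynomial.coeff_C_mul]
      rcases hk.lt_or_eq with hk | rfl
      · rw [Polynomial.coeff_eq_zero_of_natDegree_lt (by rw [hdeg]; exact hk), if_neg hk.ne']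
        simp
      · have := hmonic.coeff_natDegree
        rw [hdeg] at this
        rw [this]; simp
    · intro x hx
      obtain ⟨l, hl, rfl⟩ := Finset.mem_image.1 hx
      have hl := Finset.mem_range.1 hl
      have e1 := hinc l
      rw [symbol_eq_one hN hl, symbol_eq_one hN hl.le, sub_self] at e1
      have e1 := (mul_eq_zero.1 e1.symm).resolve_left (pow_ne_zero _ (node_ne_zero _ _ _))
      rw [Polynomial.eval_sub, e1, hQ, Polynomial.eval_mul, Polynomial.eval_prod,
        Finset.prod_eq_zero (Finset.mem_range.2 hl) (by simp)]
      simp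
  rw [hinc, hPQ, hQ]
  simp only [Polynomial.eval_mul, Polynomial.eval_C, Polynomial.eval_prod, Polynomial.eval_sub,
    Polynomial.eval_X]
  ring

theorem conj_node (h N t : ℕ) : (starRingEnd ℂ) (node h N t) = (node h N t)⁻¹ := by
  rw [node, conj_rot, rot_neg]

theorem conj_weight {h N t : ℕ} (hN : N < h) (ht : t ≤ N) :
    (starRingEnd ℂ) (weight h N t) = node h N t ^ N * weight h N t := by
  have hcard : ((Finset.range (N + 1)).erase t).card = N := by
    rw [Finset.card_erase_of_mem (Finset.mem_range.2 (by omega))]; simp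
  have : node h N t ^ N = ∏ s ∈ (Finset.range (N + 1)).erase t, node h N t := by
    rw [Finset.prod_const, hcard]
  rw [this, weight, map_prod, ← Finset.prod_mul_distrib]
  refine Finset.prod_congr rfl fun s hs => ?_
  rw [Finset.mem_erase] at hs
  have hne : node h N t - node h N s ≠ 0 := sub_ne_zero.2 fun e =>
    hs.1 (node_injOn hN hs.2 (Finset.mem_coe.2 (Finset.mem_range.2 (by omega))) e.symm)
  have hne' : node h N s - node h N t ≠ 0 := by rwa [← neg_sub, neg_ne_zero]
  have h1 := node_ne_zero h N t
  have h2 := node_ne_zero h N s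
  simp only [map_div₀, map_sub, map_one, conj_node]
  have e : (node h N t)⁻¹ - (node h N s)⁻¹ =
      (node h N s - node h N t) * ((node h N t)⁻¹ * (node h N s)⁻¹) := by
    field_simp
  rw [e]
  field_simp
  ring

/-- All nodes share the same `h`-th power and `conj_weight` supplies the `N`-th power, so the
reflection is conjugation up to a unimodular constant. -/
theorem norm_symbol_symm {h N r : ℕ} (hN : N < h) (hr : r ≤ N + h) :
    ‖symbol h N (N + h - r)‖ = ‖symbol h N r‖ := by
  have hh : h ≠ 0 := by omega
  have key : symbol h N (N + h - r) = node h N 0 ^ h * (starRingEnd ℂ) (symbol h N r) := by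
    rw [symbol, symbol, map_sum, Finset.mul_sum]
    refine Finset.sum_congr rfl fun t ht => ?_
    have ht := Finset.mem_range.1 ht
    have e1 : node h N t ^ h = node h N 0 ^ h := by
      rw [node_eq, mul_pow, ← pow_mul, mul_comm t h, pow_mul, rot_pow, mul_comm (h : ℝ) 2]
      have := rot_two_mul_int hh 1
      rw [Int.cast_one, mul_one] at this
      rw [this]; simp
    rw [map_mul, map_pow, conj_node, conj_weight hN (by omega), ← e1,
      pow_sub₀ _ (node_ne_zero _ _ _) hr, pow_add, inv_pow]
    ring
  rw [key, norm_mul, norm_pow, Complex.norm_conj]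
  simp [node]

theorem prod_rot_range (h N : ℕ) :
    ∏ l ∈ Finset.range N, rot h l = rot h (N * (N - 1) / 2) := by
  induction N with
  | zero => simp
  | succ N ih =>
    rw [Finset.prod_range_succ, ih, ← rot_add]; congr 1; push_cast; ring

theorem prod_rot_two_sub (h N r : ℕ) :
    ∏ l ∈ Finset.range N, (rot h 2 ^ r - rot h 2 ^ l) =
      (2 * Complex.I) ^ N * sineProd h N r * rot h (N * r) * rot h (N * (N - 1) / 2) := by
  have : ∀ l : ℕ, rot h 2 ^ r - rot h 2 ^ l =
      2 * Complex.I * ((Real.sin (Real.pi * (r - l) / h) : ℝ) : ℂ) * rot h r * rot h l := by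
    intro l
    rw [rot_pow, rot_pow, rot_sub_rot, mul_assoc _ (rot h r), ← rot_add]
    congr 4 <;> ring
  rw [Finset.prod_congr rfl fun l _ => this l]
  simp only [Finset.prod_mul_distrib, Finset.prod_const, Finset.card_range]
  rw [prod_rot_range, rot_pow, sineProd, Complex.ofReal_prod, mul_pow]

/-- The real factor of the increments of `symbol`. -/
noncomputable def incFactor (h N : ℕ) : ℝ :=
  (∏ s ∈ Finset.range N,
    -Real.sin (Real.pi * (s - N / 2 + 1 / 4) / h) / Real.sin (Real.pi * (N - s) / h)) *
    Real.sin (Real.pi * (N - N / 2 + 1 / 4) / h)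

theorem weight_mul_node_sub_one {h N : ℕ} (hN : N < h) :
    weight h N N * (node h N N - 1) =
      2 * Complex.I * incFactor h N * rot h ((1 - N) * (N / 2 + 1 / 4)) := by
  have h1 : ∀ s ∈ Finset.range N, (1 - node h N s) / (node h N N - node h N s) =
      ((-Real.sin (Real.pi * (s - N / 2 + 1 / 4) / h) / Real.sin (Real.pi * (N - s) / h) : ℝ) : ℂ) *
        rot h (-(N / 2 + 1 / 4)) := by
    intro s hs
    have hs := Finset.mem_range.1 hs
    have e1 : 1 - node h N s = -(2 * Complex.I *
        Real.sin (Real.pi * (s - N / 2 + 1 / 4) / h) * rot h (s - N / 2 + 1 / 4)) := by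
      rw [← neg_sub, ← rot_zero h, node, rot_sub_rot]
      congr 3 <;> [congr 4; skip] <;> ring
    have e2 : node h N N - node h N s = 2 * Complex.I *
        Real.sin (Real.pi * (N - s) / h) * (rot h (N / 2 + 1 / 4) * rot h (s - N / 2 + 1 / 4)) := by
      rw [node, node, rot_sub_rot, ← rot_add]
      congr 2 <;> [congr 4; skip] <;> ring
    have hsN : (s : ℝ) < N := by exact_mod_cast hs
    have hNh : (N : ℝ) < h := by exact_mod_cast hN
    have hs0 : (0 : ℝ) ≤ s := s.cast_nonneg
    have hsin : ((Real.sin (Real.pi * (N - s) / h) : ℝ) : ℂ) ≠ 0 :=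
      Complex.ofReal_ne_zero.2 (sin_pi_mul_div_pos (by linarith) (by linarith)).ne'
    rw [e1, e2, rot_neg, Complex.ofReal_div, Complex.ofReal_neg]
    have n1 := rot_ne_zero h (N / 2 + 1 / 4)
    have n2 := rot_ne_zero h (s - N / 2 + 1 / 4)
    have n3 := Complex.I_ne_zero
    generalize rot h (N / 2 + 1 / 4) = u at *
    generalize rot h (s - N / 2 + 1 / 4) = v at *
    generalize Real.sin (Real.pi * (s - N / 2 + 1 / 4) / h) = x at *
    generalize Real.sin (Real.pi * (N - s) / h) = y at *
    field_simp
  have h2 : node h N N - 1 = 2 * Complex.I *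
      Real.sin (Real.pi * (N - N / 2 + 1 / 4) / h) * rot h (N / 2 + 1 / 4) := by
    rw [← rot_zero h, node, rot_sub_rot]
    congr 2 <;> [congr 4; skip] <;> ring
  rw [weight, Finset.range_add_one, Finset.erase_insert (by simp), Finset.prod_congr rfl h1,
    Finset.prod_mul_distrib, Finset.prod_const, Finset.card_range, h2, rot_pow, incFactor,
    Complex.ofReal_mul, Complex.ofReal_prod,
    show (1 - (N : ℝ)) * (N / 2 + 1 / 4) = N * -(N / 2 + 1 / 4) + (N / 2 + 1 / 4) by ring,
    rot_add h (N * -(N / 2 + 1 / 4))]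
  ring

/-- Every phase depending on `r` cancels except the one from the offset `1 / 4` of the nodes, so the
edges turn at the rate `δ = 1 / 4`. -/
theorem symbol_increment {h N : ℕ} (hN : N < h) (r : ℕ) :
    symbol h N (r + 1) - symbol h N r =
      ((2 * Complex.I) ^ (N + 1) * incFactor h N * rot h (-((N - 1) / 4))) *
        rot h (2 * (1 / 4) * r) * sineProd h N r := by
  rw [symbol_succ_sub hN, weight_mul_node_sub_one hN, prod_rot_two_sub, node, rot_pow]
  have : rot h ((1 - N) * (N / 2 + 1 / 4)) * rot h (r * (2 * ((0 : ℕ) - N / 2 + 1 / 4))) *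
      (rot h (N * r) * rot h (N * (N - 1) / 2)) =
      rot h (-((N - 1) / 4)) * rot h (2 * (1 / 4) * r) := by
    simp only [← rot_add]
    congr 1; push_cast; ring
  rw [pow_succ]
  linear_combination (2 * Complex.I * incFactor h N * (2 * Complex.I) ^ N * sineProd h N r) * this

/-- The factors with `s < (N + 1) / 2` are positive and the other `N - (N + 1) / 2` negative; the
offset `1 / 4` prevents a zero. -/
theorem incFactor_sign {h N : ℕ} (hN : 1 ≤ N) (hNh : N < h) :
    0 < (-1) ^ (N - (N + 1) / 2) * incFactor h N := by
  obtain ⟨M, hM⟩ : ∃ M, M = (N + 1) / 2 := ⟨_, rfl⟩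
  rw [← hM]
  have hNh' : (N : ℝ) < h := by exact_mod_cast hNh
  have hM1 : 2 * (M : ℝ) ≤ N + 1 := by exact_mod_cast (by omega : 2 * M ≤ N + 1)
  have hM2 : (N : ℝ) ≤ 2 * M := by exact_mod_cast (by omega : N ≤ 2 * M)
  have hden : ∀ s < N, 0 < Real.sin (Real.pi * (N - s) / h) := by
    intro s hs
    have hsN : (s : ℝ) < N := by exact_mod_cast hs
    have hs0 : (0 : ℝ) ≤ s := s.cast_nonneg
    exact sin_pi_mul_div_pos (by linarith) (by linarith)
  have hhigh : ∀ s, M ≤ s → s ≤ N → 0 < Real.sin (Real.pi * (s - N / 2 + 1 / 4) / h) := by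
    intro s h1 h2
    have h1 : (M : ℝ) ≤ s := by exact_mod_cast h1
    have h2 : (s : ℝ) ≤ N := by exact_mod_cast h2
    have h3 : (1 : ℝ) ≤ N := by exact_mod_cast hN
    exact sin_pi_mul_div_pos (by linarith) (by linarith)
  have hlow : ∀ s < M, 0 < -Real.sin (Real.pi * (s - N / 2 + 1 / 4) / h) := by
    intro s h1
    have h1 : (s : ℝ) + 1 ≤ M := by exact_mod_cast h1
    have h2 : (0 : ℝ) ≤ s := s.cast_nonneg
    have h3 : (1 : ℝ) ≤ N := by exact_mod_cast hN
    rw [← Real.sin_neg, ← neg_div, ← mul_neg]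
    exact sin_pi_mul_div_pos (by linarith) (by linarith)
  have key : ∀ k, M + k ≤ N → 0 < (-1) ^ k * ∏ s ∈ Finset.range (M + k),
      -Real.sin (Real.pi * (s - N / 2 + 1 / 4) / h) / Real.sin (Real.pi * (N - s) / h) := by
    intro k
    induction k with
    | zero =>
      intro hk
      rw [pow_zero, one_mul]
      refine Finset.prod_pos fun s hs => ?_
      have hs : s < M + 0 := Finset.mem_range.1 hs
      exact div_pos (hlow s hs) (hden s (by omega))
    | succ k ih =>
      intro hk
      have h1 := ih (by omega)
      rw [← add_assoc, Finset.prod_range_succ, pow_succ]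
      have h2 := div_pos (hhigh (M + k) (by omega) (by omega)) (hden (M + k) (by omega))
      have := mul_pos h1 h2
      rw [neg_div]
      linarith
  have h1 := key (N - M) (by omega)
  rw [show M + (N - M) = N by omega] at h1
  have := mul_pos h1 (hhigh N (by omega) le_rfl)
  rwa [mul_assoc] at this

theorem norm_symbol_lt_one {h N r : ℕ} (hN : 1 ≤ N) (hNh : N + 3 ≤ h) (hpar : (N + h) % 2 = 1)
    (hr : N < r) (hrh : r < h) : ‖symbol h N r‖ < 1 := by
  refine norm_lt_one_of_increments hN hNh hpar (δ := 1 / 4) (by norm_num) le_rfl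
    (fun r => symbol_increment (by omega) r) (fun r hr => symbol_eq_one (by omega) hr)
    (fun r hr => norm_symbol_symm (by omega) hr) ?_ r hr hrh
  have hsign := incFactor_sign hN (by omega : N < h)
  have e : (2 * Complex.I) ^ (N + 1) * incFactor h N * rot h (-((N - 1) / 4)) *
      rot h (2 * (1 / 4) * (N - 1)) =
      (2 * Complex.I) ^ (N + 1) * incFactor h N * rot h ((N - 1) / 4) := by
    rw [mul_assoc _ (rot h _), ← rot_add]; congr 2; ring
  rw [e]
  have hh0 : (0 : ℝ) < h := by exact_mod_cast (by omega : 0 < h)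
  have hNh' : (N : ℝ) < h := by exact_mod_cast (by omega : N < h)
  have hsq : (2 * Complex.I) ^ 2 = -4 := by rw [mul_pow, Complex.I_sq]; norm_num
  -- The power of `I` is imaginary for even `N` and real for odd `N`, so the real part is a negative
  -- multiple of a sine or of a cosine respectively.
  rcases Nat.even_or_odd' N with ⟨j, hj | hj⟩
  · have h1 : (2 * Complex.I) ^ (N + 1) * incFactor h N =
        ((2 * 4 ^ j * ((-1) ^ (N - (N + 1) / 2) * incFactor h N) : ℝ) : ℂ) * Complex.I := by
      rw [show N - (N + 1) / 2 = j by omega, hj, pow_succ, pow_mul, hsq,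
        show (-4 : ℂ) = (-1) * 4 by norm_num, mul_pow]
      push_cast; ring
    rw [h1, mul_assoc, Complex.re_ofReal_mul, Complex.I_mul_re, rot_im]
    have h2 : (2 : ℝ) ≤ N := by exact_mod_cast (by omega : 2 ≤ N)
    have := sin_pi_mul_div_pos (h := h) (x := ((N : ℝ) - 1) / 4) (by linarith) (by linarith)
    have := mul_pos (mul_pos (by positivity : (0 : ℝ) < 2 * 4 ^ j) hsign) this
    linarith
  · have h1 : (2 * Complex.I) ^ (N + 1) * incFactor h N =
        ((-(4 ^ (j + 1) * ((-1) ^ (N - (N + 1) / 2) * incFactor h N)) : ℝ) : ℂ) := by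
      rw [show N - (N + 1) / 2 = j by omega, hj, show 2 * j + 1 + 1 = 2 * (j + 1) by ring, pow_mul,
        hsq, show (-4 : ℂ) = (-1) * 4 by norm_num, mul_pow, pow_succ (-1 : ℂ)]
      push_cast; ring
    rw [h1, Complex.re_ofReal_mul, rot_re]
    have h2 : (1 : ℝ) ≤ N := by exact_mod_cast hN
    have hpi := Real.pi_pos
    have hcos : 0 < Real.cos (Real.pi * (((N : ℝ) - 1) / 4) / h) := by
      have h3 : (0 : ℝ) ≤ ((N : ℝ) - 1) / 4 := by linarith
      refine Real.cos_pos_of_mem_Ioo ⟨?_, ?_⟩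
      · have : 0 ≤ Real.pi * (((N : ℝ) - 1) / 4) / h := by positivity
        linarith
      · rw [div_lt_iff₀ hh0]
        have := mul_lt_mul_of_pos_left (show ((N : ℝ) - 1) / 4 < h / 2 by linarith) hpi
        linarith
    have := mul_pos (mul_pos (by positivity : (0 : ℝ) < 4 ^ (j + 1)) hsign) hcos
    linarith

/-! ### The minimal family -/

/-- Generalised Vandermonde determinants do not vanish: few coefficients are determined by as many
power sums. -/
theorem eq_zero_of_sum_mul_pow_eq_zero {ι : Type*} [Fintype ι] {x : ι → ℂ}
    (hx : Function.Injective x) {c : ι → ℂ} {N : ℕ}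
    (hcard : (Finset.univ.filter fun i => c i ≠ 0).card ≤ N + 1)
    (hc : ∀ r ≤ N, ∑ i, c i * x i ^ r = 0) : c = 0 := by
  classical
  by_contra hne
  obtain ⟨i₀, hi₀⟩ := Function.ne_iff.1 hne
  set S := Finset.univ.filter fun i => c i ≠ 0 with hS
  have hi₀S : i₀ ∈ S := by simpa [hS] using hi₀
  -- Tested against this polynomial, which vanishes at every other node of the support, the power
  -- sums isolate `c i₀`.
  set P : Polynomial ℂ := ∏ j ∈ S.erase i₀, (Polynomial.X - Polynomial.C (x j)) with hP
  have hdeg : P.natDegree < N + 1 := by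
    rw [hP, Polynomial.natDegree_prod_of_monic _ _ fun l _ => Polynomial.monic_X_sub_C _]
    simp only [Polynomial.natDegree_X_sub_C, Finset.sum_const, smul_eq_mul, mul_one]
    rw [Finset.card_erase_of_mem hi₀S]
    have : 0 < S.card := Finset.card_pos.2 ⟨_, hi₀S⟩
    omega
  have h1 : ∑ i, c i * P.eval (x i) = 0 := by
    simp only [Polynomial.eval_eq_sum_range' hdeg, Finset.mul_sum]
    rw [Finset.sum_comm]
    refine Finset.sum_eq_zero fun k hk => ?_
    have := hc k (Nat.lt_succ_iff.1 (Finset.mem_range.1 hk))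
    rw [← mul_zero (P.coeff k), ← this, Finset.mul_sum]
    exact Finset.sum_congr rfl fun i _ => by ring
  rw [Finset.sum_eq_single i₀] at h1
  · have h2 := (mul_eq_zero.1 h1).resolve_left hi₀
    rw [hP, Polynomial.eval_prod, Finset.prod_eq_zero_iff] at h2
    obtain ⟨j, hj, hj0⟩ := h2
    rw [Polynomial.eval_sub, Polynomial.eval_X, Polynomial.eval_C, sub_eq_zero] at hj0
    exact (Finset.mem_erase.1 hj).1 (hx hj0).symm
  · intro i _ hi
    by_cases hci : c i = 0
    · rw [hci, zero_mul]
    · rw [hP, Polynomial.eval_prod, Finset.prod_eq_zero (i := i)]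
      · ring
      · simp [hS, hi, hci]
      · simp
  · simp

theorem sum_rot_fin {h : ℕ} {r s : ℕ} (hr : r < h) (hs : s < h) :
    ∑ p : Fin h, rot h (-(s * (2 * p))) * rot h (r * (2 * p)) = if s = r then (h : ℂ) else 0 := by
  have hh : h ≠ 0 := by omega
  have e : ∀ p : ℕ, rot h (-(s * (2 * p))) * rot h (r * (2 * p)) =
      rot h (p * (2 * ((r - s : ℤ) : ℝ))) := by
    intro p; rw [← rot_add]; congr 1; push_cast; ring
  simp only [e]
  rw [Fin.sum_univ_eq_sum_range (fun p => rot h (p * (2 * ((r - s : ℤ) : ℝ))))]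
  split_ifs with hrs
  · simp [hrs]
  · refine sum_rot_eq_zero hh fun hd => hrs ?_
    have := Int.eq_zero_of_abs_lt_dvd hd (by rw [abs_lt]; omega)
    omega

/-- Positions on the unit circle for the vectors in the small factor. -/
noncomputable def blockPos (h N : ℕ) : Fin h ⊕ Fin h → ℝ :=
  Sum.elim (fun p => 2 * p) (fun q => 2 * q + h - N)

/-- The vectors in the small factor. -/
noncomputable def blockLeft (h N : ℕ) (i : Fin h ⊕ Fin h) (k : Fin (N + 2)) : ℂ :=
  (√(sineBinom h (N + 1) k) : ℝ) * rot h (k * blockPos h N i)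

/-- The unimodular-on-low-frequencies multiplier coupling the two halves of `blockRight`. -/
noncomputable def blockCoupling (h N r : ℕ) : ℂ :=
  node h N 0 ^ r * (starRingEnd ℂ) (symbol h N r)

/-- The vectors in the large factor. -/
noncomputable def blockRight (h N : ℕ) :
    Fin h ⊕ Fin h → Fin h ⊕ Fin (h - (N + 1)) → ℂ :=
  Sum.elim
    (fun p => Sum.elim (fun r => rot h (r * (2 * p))) 0)
    (fun q => Sum.elim (fun r => -blockCoupling h N r * rot h (r * (2 * q)))
      (fun r => (√(1 - ‖symbol h N (r + (N + 1))‖ ^ 2) : ℝ) *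
        rot h ((r + (N + 1) : ℕ) * (2 * q))))

theorem star_blockRight_inl (h N : ℕ) (p : Fin h) (y : Fin h ⊕ Fin (h - (N + 1)) → ℂ) :
    star (blockRight h N (Sum.inl p)) ⬝ᵥ y =
      ∑ r : Fin h, rot h (-(r * (2 * p))) * y (Sum.inl r) := by
  simp [blockRight, dotProduct, conj_rot]

theorem star_blockRight_inr (h N : ℕ) (q : Fin h) (y : Fin h ⊕ Fin (h - (N + 1)) → ℂ) :
    star (blockRight h N (Sum.inr q)) ⬝ᵥ y =
      (∑ r : Fin h, -(starRingEnd ℂ) (blockCoupling h N r) * rot h (-(r * (2 * q))) *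
        y (Sum.inl r)) +
      ∑ r : Fin (h - (N + 1)), (√(1 - ‖symbol h N (r + (N + 1))‖ ^ 2) : ℝ) *
        rot h (-((r + (N + 1) : ℕ) * (2 * q))) * y (Sum.inr r) := by
  simp [blockRight, dotProduct, conj_rot]

/-- Fourier inversion: the inner products with the first cycle determine the first `h` coordinates
of `y`. -/
theorem sum_star_blockRight_inl {h N : ℕ} (y : Fin h ⊕ Fin (h - (N + 1)) → ℂ) (r : Fin h) :
    ∑ p : Fin h, star (blockRight h N (Sum.inl p)) ⬝ᵥ y * rot h (r * (2 * p)) =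
      h * y (Sum.inl r) := by
  simp only [star_blockRight_inl, Finset.sum_mul]
  rw [Finset.sum_comm]
  have : ∀ s : Fin h, ∑ p : Fin h, rot h (-(s * (2 * p))) * y (Sum.inl s) * rot h (r * (2 * p)) =
      if s = r then (h : ℂ) * y (Sum.inl s) else 0 := by
    intro s
    have := sum_rot_fin r.2 s.2
    simp only [← Fin.ext_iff] at this
    rw [← zero_mul (y (Sum.inl s)), ← ite_mul, ← this, Finset.sum_mul]
    exact Finset.sum_congr rfl fun p _ => by ring
  simp [this]

theorem sum_star_blockRight_inr {h N : ℕ} (y : Fin h ⊕ Fin (h - (N + 1)) → ℂ) (r : Fin h) :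
    ∑ q : Fin h, star (blockRight h N (Sum.inr q)) ⬝ᵥ y * rot h (r * (2 * q)) =
      -(starRingEnd ℂ) (blockCoupling h N r) * (h * y (Sum.inl r)) +
      ∑ s : Fin (h - (N + 1)), if (s : ℕ) + (N + 1) = r then
        (√(1 - ‖symbol h N (s + (N + 1))‖ ^ 2) : ℝ) * (h * y (Sum.inr s)) else 0 := by
  simp only [star_blockRight_inr, add_mul, Finset.sum_add_distrib, Finset.sum_mul]
  congr 1
  · rw [Finset.sum_comm]
    have : ∀ s : Fin h, ∑ q : Fin h, -(starRingEnd ℂ) (blockCoupling h N s) *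
        rot h (-(s * (2 * q))) * y (Sum.inl s) * rot h (r * (2 * q)) =
        if s = r then -(starRingEnd ℂ) (blockCoupling h N s) * (h * y (Sum.inl s)) else 0 := by
      intro s
      have := sum_rot_fin r.2 s.2
      simp only [← Fin.ext_iff] at this
      have e : (if s = r then -(starRingEnd ℂ) (blockCoupling h N s) * (h * y (Sum.inl s)) else 0)
          = (if s = r then (h : ℂ) else 0) *
            (-(starRingEnd ℂ) (blockCoupling h N s) * y (Sum.inl s)) := by
        split_ifs <;> ring
      rw [e, ← this, Finset.sum_mul]
      exact Finset.sum_congr rfl fun p _ => by ring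
    rw [Finset.sum_congr rfl fun s _ => this s, Finset.sum_ite_eq', if_pos (Finset.mem_univ r)]
  · rw [Finset.sum_comm]
    refine Finset.sum_congr rfl fun s _ => ?_
    have := sum_rot_fin r.2 (show (s : ℕ) + (N + 1) < h by have := s.2; omega)
    have e : (if (s : ℕ) + (N + 1) = r then
        (√(1 - ‖symbol h N (s + (N + 1))‖ ^ 2) : ℝ) * (h * y (Sum.inr s)) else 0) =
        (if (s : ℕ) + (N + 1) = r then (h : ℂ) else 0) *
          ((√(1 - ‖symbol h N (s + (N + 1))‖ ^ 2) : ℝ) * y (Sum.inr s)) := by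
      split_ifs <;> ring
    rw [e, ← this, Finset.sum_mul]
    exact Finset.sum_congr rfl fun p _ => by ring

theorem blockCoupling_of_le {h N r : ℕ} (hN : N < h) (hr : r ≤ N) :
    (starRingEnd ℂ) (blockCoupling h N r) * node h N 0 ^ r = 1 := by
  rw [blockCoupling, symbol_eq_one hN hr, map_one, mul_one, map_pow, conj_node, inv_pow,
    inv_mul_cancel₀ (pow_ne_zero _ (node_ne_zero _ _ _))]

theorem norm_blockCoupling (h N r : ℕ) : ‖blockCoupling h N r‖ = ‖symbol h N r‖ := by
  rw [blockCoupling, norm_mul, norm_pow, Complex.norm_conj, node, norm_rot, one_pow, one_mul]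

/-- The factor `node h N 0 ^ r` removes the common phase of the nodes, leaving characters mod `h`
with shifts in `{0, ..., N}` only. -/
theorem blockCoupling_eq_sum (h N r : ℕ) :
    blockCoupling h N r = ∑ t ∈ Finset.range (N + 1),
      (starRingEnd ℂ) (weight h N t) * rot h (-(r * (2 * t))) := by
  rw [blockCoupling, symbol, map_sum, Finset.mul_sum]
  refine Finset.sum_congr rfl fun t _ => ?_
  have : node h N 0 ^ r * (starRingEnd ℂ) (node h N t ^ r) = rot h (-(r * (2 * t))) := by
    rw [map_pow, conj_node, node_eq h N t, mul_inv, mul_pow, inv_pow, mul_inv_cancel_left₀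
      (pow_ne_zero _ (node_ne_zero _ _ _)), rot_pow, inv_pow, rot_pow, ← rot_neg]
    congr 2; ring
  rw [map_mul, ← this]; ring

theorem star_blockLeft (h N : ℕ) (i : Fin h ⊕ Fin h) (x : Fin (N + 2) → ℂ) :
    star (blockLeft h N i) ⬝ᵥ x =
      ∑ k : Fin (N + 2), (√(sineBinom h (N + 1) k) : ℝ) * x k * rot h (-blockPos h N i) ^ (k : ℕ) := by
  simp only [dotProduct, Pi.star_apply, blockLeft, RCLike.star_def, map_mul, Complex.conj_ofReal,
    conj_rot, rot_pow]
  refine Finset.sum_congr rfl fun k _ => ?_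
  rw [mul_neg]; ring

theorem star_blockLeft_blockLeft {h N : ℕ} (hN : N + 1 < h) (i j : Fin h ⊕ Fin h) :
    star (blockLeft h N i) ⬝ᵥ blockLeft h N j =
      sinePoly h (N + 1) (rot h (blockPos h N j - blockPos h N i)) := by
  rw [star_blockLeft, sinePoly, Finset.sum_range]
  refine Finset.sum_congr rfl fun k _ => ?_
  have hk := (sineBinom_pos hN (Nat.lt_succ_iff.1 k.2)).le
  have h1 : ((√(sineBinom h (N + 1) k) : ℝ) : ℂ) * (√(sineBinom h (N + 1) k) : ℝ) =
      sineBinom h (N + 1) k := by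
    rw [← Complex.ofReal_mul, Real.mul_self_sqrt hk]
  rw [blockLeft, sub_eq_add_neg, rot_add, mul_pow, ← h1, rot_pow, rot_pow]
  ring

/-- The shift `h - N` in `blockPos` sends the differences `0, ..., N` to the `N + 1` roots found in
`sinePoly_root`. -/
theorem star_blockLeft_inl_inr {h N : ℕ} (hN : N + 1 < h) {p q : Fin h} {t : ℕ} (ht : t ≤ N)
    (hd : (h : ℤ) ∣ q - p - t) :
    star (blockLeft h N (Sum.inl p)) ⬝ᵥ blockLeft h N (Sum.inr q) = 0 := by
  have hh : h ≠ 0 := by omega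
  obtain ⟨n, hn⟩ := hd
  have hn' : (q : ℝ) - p - t = h * n := by exact_mod_cast hn
  rw [star_blockLeft_blockLeft hN]
  have : rot h (blockPos h N (Sum.inr q) - blockPos h N (Sum.inl p)) =
      -rot h (1 - (N + 1 : ℕ) + 2 * t) := by
    have e : blockPos h N (Sum.inr q) - blockPos h N (Sum.inl p) =
        (1 - (N + 1 : ℕ) + 2 * t) + (h + 2 * h * n) := by
      simp only [blockPos, Sum.elim_inl, Sum.elim_inr]
      push_cast; linarith
    rw [e, rot_add, rot_add h h, rot_self hh, rot_two_mul_int hh]; ring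
  rw [this]
  exact sinePoly_root hN (by omega)

theorem star_blockRight_inl_inr {h N : ℕ} (hh : h ≠ 0) {p q : Fin h}
    (hd : ∀ t ≤ N, ¬ (h : ℤ) ∣ q - p - t) :
    star (blockRight h N (Sum.inl p)) ⬝ᵥ blockRight h N (Sum.inr q) = 0 := by
  rw [star_blockRight_inl]
  simp only [blockRight, Sum.elim_inr, Sum.elim_inl, blockCoupling_eq_sum]
  have : ∀ r : Fin h, rot h (-(r * (2 * p))) *
      (-(∑ t ∈ Finset.range (N + 1), (starRingEnd ℂ) (weight h N t) * rot h (-(r * (2 * t)))) *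
        rot h (r * (2 * q))) = ∑ t ∈ Finset.range (N + 1), -(starRingEnd ℂ) (weight h N t) *
          rot h (r * (2 * ((q - p - t : ℤ) : ℝ))) := by
    intro r
    rw [← Finset.sum_neg_distrib, Finset.sum_mul, Finset.mul_sum]
    refine Finset.sum_congr rfl fun t _ => ?_
    have : rot h (r * (2 * ((q - p - t : ℤ) : ℝ))) =
        rot h (-(r * (2 * p))) * rot h (-(r * (2 * t))) * rot h (r * (2 * q)) := by
      rw [← rot_add, ← rot_add]; congr 1; push_cast; ring
    rw [this]; ring
  simp only [this]
  rw [Finset.sum_comm]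
  refine Finset.sum_eq_zero fun t ht => ?_
  rw [← Finset.mul_sum, Fin.sum_univ_eq_sum_range
    (fun r => rot h (r * (2 * ((q - p - t : ℤ) : ℝ)))), sum_rot_eq_zero hh, mul_zero]
  exact hd t (Nat.lt_succ_iff.1 (Finset.mem_range.1 ht))

theorem star_blockRight_inl_inl {h N : ℕ} {p q : Fin h} (hpq : p ≠ q) :
    star (blockRight h N (Sum.inl p)) ⬝ᵥ blockRight h N (Sum.inl q) = 0 := by
  rw [star_blockRight_inl]
  simp only [blockRight, Sum.elim_inl]
  have := sum_rot_fin q.2 p.2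
  rw [if_neg (Fin.val_injective.ne hpq)] at this
  rw [← this]
  refine Finset.sum_congr rfl fun r _ => ?_
  congr 2 <;> ring

/-- At each frequency the weights `‖symbol‖ ^ 2` and `1 - ‖symbol‖ ^ 2` add to `1`, so the sum is a
plain character sum. For `r ≤ N` the second weight is zero, and no coordinate is spent on it. -/
theorem star_blockRight_inr_inr {h N : ℕ} (hN : 1 ≤ N) (hNh : N + 3 ≤ h)
    (hpar : (N + h) % 2 = 1) {p q : Fin h} (hpq : p ≠ q) :
    star (blockRight h N (Sum.inr p)) ⬝ᵥ blockRight h N (Sum.inr q) = 0 := by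
  rw [star_blockRight_inr]
  simp only [blockRight, Sum.elim_inr, Sum.elim_inl]
  set f : ℕ → ℂ := fun r => rot h (-(p * (2 * r))) * rot h (q * (2 * r)) with hf
  have e1 : ∀ r : Fin h, -(starRingEnd ℂ) (blockCoupling h N r) * rot h (-(r * (2 * p))) *
      (-blockCoupling h N r * rot h (r * (2 * q))) = (‖symbol h N r‖ ^ 2 : ℝ) * f r := by
    intro r
    rw [← norm_blockCoupling, ← Complex.normSq_eq_norm_sq, Complex.normSq_eq_conj_mul_self, hf]
    dsimp only
    rw [show (r : ℝ) * (2 * p) = p * (2 * r) by ring, show (r : ℝ) * (2 * q) = q * (2 * r) by ring]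
    ring
  have e2 : ∀ r : Fin (h - (N + 1)), ((√(1 - ‖symbol h N (r + (N + 1))‖ ^ 2) : ℝ) : ℂ) *
      rot h (-((r + (N + 1) : ℕ) * (2 * p))) *
      ((√(1 - ‖symbol h N (r + (N + 1))‖ ^ 2) : ℝ) * rot h ((r + (N + 1) : ℕ) * (2 * q))) =
      (1 - ‖symbol h N (N + 1 + r)‖ ^ 2 : ℝ) * f (N + 1 + r) := by
    intro r
    have hr := r.2
    have hlt := norm_symbol_lt_one hN hNh hpar (show N < r + (N + 1) by omega) (by omega)
    have h1 : (0 : ℝ) ≤ 1 - ‖symbol h N (r + (N + 1))‖ ^ 2 := by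
      nlinarith [norm_nonneg (symbol h N (r + (N + 1)))]
    have h2 : ((√(1 - ‖symbol h N (r + (N + 1))‖ ^ 2) : ℝ) : ℂ) *
        (√(1 - ‖symbol h N (r + (N + 1))‖ ^ 2) : ℝ) =
        (1 - ‖symbol h N (r + (N + 1))‖ ^ 2 : ℝ) := by
      rw [← Complex.ofReal_mul, Real.mul_self_sqrt h1]
    rw [add_comm (N + 1), ← h2, hf]
    dsimp only
    rw [mul_comm ((r + (N + 1) : ℕ) : ℝ), mul_comm ((r + (N + 1) : ℕ) : ℝ)]
    rw [show 2 * (p : ℝ) * (r + (N + 1) : ℕ) = p * (2 * (r + (N + 1) : ℕ)) by ring,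
      show 2 * (q : ℝ) * (r + (N + 1) : ℕ) = q * (2 * (r + (N + 1) : ℕ)) by ring]
    ring
  simp only [e1, e2]
  rw [Fin.sum_univ_eq_sum_range (fun r => ((‖symbol h N r‖ ^ 2 : ℝ) : ℂ) * f r),
    Fin.sum_univ_eq_sum_range (fun r => ((1 - ‖symbol h N (N + 1 + r)‖ ^ 2 : ℝ) : ℂ) *
      f (N + 1 + r))]
  obtain ⟨k, hk⟩ := Nat.exists_eq_add_of_le (show N + 1 ≤ h by omega)
  have e3 : ∑ r ∈ Finset.range h, f r = 0 := by
    have := sum_rot_fin q.2 p.2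
    rw [if_neg (Fin.val_injective.ne hpq), Fin.sum_univ_eq_sum_range f] at this
    exact this
  have hk' : h - (N + 1) = k := by omega
  have split : ∀ F : ℕ → ℂ, ∑ r ∈ Finset.range h, F r =
      ∑ r ∈ Finset.range (N + 1), F r + ∑ r ∈ Finset.range k, F (N + 1 + r) := by
    intro F; rw [hk, Finset.sum_range_add]
  rw [hk', ← e3, split, split, add_assoc, ← Finset.sum_add_distrib]
  congr 1
  · refine Finset.sum_congr rfl fun r hr => ?_
    have := symbol_eq_one (h := h) (N := N) (r := r) (by omega) (by
      have := Finset.mem_range.1 hr; omega)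
    rw [this]; simp
  · refine Finset.sum_congr rfl fun r _ => ?_
    push_cast; ring

theorem star_dotProduct_eq_zero_comm {α : Type*} [Fintype α] {v w : α → ℂ} :
    star v ⬝ᵥ w = 0 ↔ star w ⬝ᵥ v = 0 := by
  rw [Matrix.star_dotProduct, star_eq_zero]

/-- As `h - N` is odd, the two cycles sit at even and odd positions. -/
theorem rot_neg_blockPos_injective {h N : ℕ} (hNh : N + 3 ≤ h) (hpar : (N + h) % 2 = 1) :
    Function.Injective fun i => rot h (-blockPos h N i) := by
  have hh : h ≠ 0 := by omega
  intro i j hij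
  obtain ⟨n, hn⟩ := (rot_eq_rot_iff hh _ _).1 hij
  have cross : ∀ p q : Fin h, ¬ ∃ n : ℤ, blockPos h N (Sum.inl p) - blockPos h N (Sum.inr q) =
      2 * h * n := by
    rintro p q ⟨n, hn⟩
    simp only [blockPos, Sum.elim_inl, Sum.elim_inr] at hn
    have h1 : (2 * p - (2 * q + h - N) : ℤ) = 2 * (h * n) := by
      have : (2 * p - (2 * q + h - N) : ℝ) = 2 * (h * n) := by linarith
      exact_mod_cast this
    generalize (h : ℤ) * n = k at h1
    omega
  have same : ∀ p q : Fin h, (q : ℝ) - p = h * n → p = q := by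
    intro p q H
    have h1 : (q : ℤ) - p = h * n := by exact_mod_cast H
    have := Int.eq_zero_of_abs_lt_dvd ⟨n, h1⟩ (by rw [abs_lt]; omega)
    exact Fin.ext (by omega)
  rcases i with p | p <;> rcases j with q | q
  · simp only [blockPos, Sum.elim_inl] at hn
    rw [same p q (by linarith)]
  · exact (cross p q ⟨-n, by push_cast; linarith⟩).elim
  · exact (cross q p ⟨n, by linarith⟩).elim
  · simp only [blockPos, Sum.elim_inr] at hn
    rw [same p q (by linarith)]

/-- The offset `1 / 4` separates the two cycles: four times the relevant difference is odd. -/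
theorem blockNode_injective {h N : ℕ} (hNh : N < h) :
    Function.Injective (Sum.elim (fun p : Fin h => rot h (2 * p))
      (fun q : Fin h => node h N 0 * rot h (2 * q))) := by
  have hh : h ≠ 0 := by omega
  have hpow : ∀ p : ℕ, rot h (2 * p) = rot h 2 ^ p := by
    intro p; rw [rot_pow, mul_comm]
  have cross : ∀ p q : Fin h, rot h (2 * p) ≠ node h N 0 * rot h (2 * q) := by
    intro p q H
    rw [node, ← rot_add, rot_eq_rot_iff hh] at H
    obtain ⟨n, hn⟩ := H
    push_cast at hn
    have h1 : (4 * p + 2 * N - 1 - 4 * q : ℤ) = 4 * (h * n) := by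
      have : (4 * p + 2 * N - 1 - 4 * q : ℝ) = 4 * (h * n) := by linarith
      exact_mod_cast this
    generalize (h : ℤ) * n = k at h1
    omega
  rintro (p | p) (q | q) hpq <;> simp only [Sum.elim_inl, Sum.elim_inr] at hpq
  · rw [hpow, hpow] at hpq
    rw [Fin.ext (rot_two_pow_injOn hh p.2 q.2 hpq)]
  · exact (cross p q hpq).elim
  · exact (cross q p hpq.symm).elim
  · have := mul_left_cancel₀ (node_ne_zero h N 0) hpq
    rw [hpow, hpow] at this
    rw [Fin.ext (rot_two_pow_injOn hh p.2 q.2 this)]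

/-- Orthogonality to `x` means that a nonzero polynomial of degree at most `N + 1` vanishes at a
point of the circle, and these points are distinct. -/
theorem card_blockLeft_orthogonal_le {h N : ℕ} (hNh : N + 3 ≤ h) (hpar : (N + h) % 2 = 1)
    {x : Fin (N + 2) → ℂ} (hx : x ≠ 0) :
    (Finset.univ.filter fun i => star (blockLeft h N i) ⬝ᵥ x = 0).card ≤ N + 1 := by
  classical
  by_contra! hcard
  set S := Finset.univ.filter fun i => star (blockLeft h N i) ⬝ᵥ x = 0 with hS
  set P : Polynomial ℂ := ∑ k : Fin (N + 2),
    Polynomial.C ((√(sineBinom h (N + 1) k) : ℝ) * x k) * Polynomial.X ^ (k : ℕ) with hP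
  have hP0 : P = 0 := by
    refine Polynomial.eq_zero_of_degree_lt_of_eval_finset_eq_zero
      (S.image fun i => rot h (-blockPos h N i)) ?_ ?_
    · rw [Finset.card_image_of_injective _ (rot_neg_blockPos_injective hNh hpar)]
      refine (Polynomial.degree_sum_fin_lt _).trans_le ?_
      exact_mod_cast hcard
    · intro z hz
      obtain ⟨i, hi, rfl⟩ := Finset.mem_image.1 hz
      have := (Finset.mem_filter.1 hi).2
      rw [star_blockLeft] at this
      simpa [hP, Polynomial.eval_finsetSum] using this
  apply hx
  ext k
  have h1 := congrArg (fun Q => Polynomial.coeff Q k) hP0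
  simp only [hP, Polynomial.finsetSum_coeff, Polynomial.coeff_C_mul_X_pow, Polynomial.coeff_zero,
    ← Fin.ext_iff] at h1
  rw [Finset.sum_ite_eq, if_pos (Finset.mem_univ k)] at h1
  refine (mul_eq_zero.1 h1).resolve_left ?_
  have := sineBinom_pos (h := h) (e := N + 1) (by omega) (Nat.lt_succ_iff.1 k.2)
  exact Complex.ofReal_ne_zero.2 (Real.sqrt_pos.2 this).ne'

/-- For each `r ≤ N` the Fourier sums over the two cycles cancel, giving `N + 1` vanishing power
sums of the inner products. With at most `N + 1` of them nonzero, Vandermonde makes all of them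
zero, and Fourier inversion then gives `y = 0`. -/
theorem blockRight_eq_zero {h N : ℕ} (hN : 1 ≤ N) (hNh : N + 3 ≤ h) (hpar : (N + h) % 2 = 1)
    {y : Fin h ⊕ Fin (h - (N + 1)) → ℂ}
    (hcard : (Finset.univ.filter fun i => star (blockRight h N i) ⬝ᵥ y ≠ 0).card ≤ N + 1) :
    y = 0 := by
  have hh : (h : ℂ) ≠ 0 := Nat.cast_ne_zero.2 (by omega)
  have hc : (fun i => star (blockRight h N i) ⬝ᵥ y) = 0 := by
    refine eq_zero_of_sum_mul_pow_eq_zero (blockNode_injective (by omega : N < h)) hcard ?_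
    intro r hr
    have h1 := sum_star_blockRight_inl y ⟨r, by omega⟩
    have h2 := sum_star_blockRight_inr y ⟨r, by omega⟩
    rw [Finset.sum_eq_zero (s := Finset.univ (α := Fin (h - (N + 1)))) fun s _ =>
      if_neg (by show ¬ (s : ℕ) + (N + 1) = r; omega), add_zero] at h2
    have h3 := blockCoupling_of_le (h := h) (by omega : N < h) hr
    rw [Fintype.sum_sum_type]
    simp only [Sum.elim_inl, Sum.elim_inr, mul_pow, rot_pow]
    rw [h1]
    have : ∀ q : Fin h, star (blockRight h N (Sum.inr q)) ⬝ᵥ y *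
        (node h N 0 ^ r * rot h (r * (2 * q))) =
        node h N 0 ^ r * (star (blockRight h N (Sum.inr q)) ⬝ᵥ y * rot h (r * (2 * q))) := by
      intro q; ring
    simp only [this]
    rw [← Finset.mul_sum, h2]
    linear_combination (-(h : ℂ) * y (Sum.inl ⟨r, by omega⟩)) * h3
  have hb : ∀ i, star (blockRight h N i) ⬝ᵥ y = 0 := fun i => congrFun hc i
  have hinl : ∀ r, y (Sum.inl r) = 0 := by
    intro r
    have := sum_star_blockRight_inl y r
    simp only [hb, zero_mul, Finset.sum_const_zero] at this
    exact (mul_eq_zero.1 this.symm).resolve_left hh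
  ext (r | s)
  · exact hinl r
  · have hs := s.2
    have := sum_star_blockRight_inr y ⟨s + (N + 1), by omega⟩
    simp only [hb, zero_mul, Finset.sum_const_zero, hinl, mul_zero, zero_add,
      add_left_inj, ← Fin.ext_iff] at this
    rw [Finset.sum_ite_eq', if_pos (Finset.mem_univ s)] at this
    have hlt := norm_symbol_lt_one hN hNh hpar (show N < s + (N + 1) by omega) (by omega)
    have hpos : (0 : ℝ) < 1 - ‖symbol h N (s + (N + 1))‖ ^ 2 := by
      nlinarith [norm_nonneg (symbol h N (s + (N + 1)))]
    have h1 := (mul_eq_zero.1 this.symm).resolve_left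
      (Complex.ofReal_ne_zero.2 (Real.sqrt_pos.2 hpos).ne')
    exact (mul_eq_zero.1 h1).resolve_left hh

theorem isUnextendibleFamily_block {h N : ℕ} (hN : 1 ≤ N) (hNh : N + 3 ≤ h)
    (hpar : (N + h) % 2 = 1) : IsUnextendibleFamily (blockLeft h N) (blockRight h N) := by
  have hh : h ≠ 0 := by omega
  refine ⟨?_, ?_, ?_, ?_⟩
  · intro i hi
    have := congrFun hi 0
    simp [blockLeft, sineBinom] at this
  · rintro (p | q) hi
    · have := congrFun hi (Sum.inl ⟨0, by omega⟩)
      simp [blockRight] at this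
    · have := congrFun hi (Sum.inl ⟨0, by omega⟩)
      have h1 := norm_blockCoupling h N 0
      rw [symbol_eq_one (by omega) (by omega), norm_one] at h1
      simp only [blockRight, Sum.elim_inr, Sum.elim_inl, CharP.cast_eq_zero, zero_mul, rot_zero,
        mul_one, Pi.zero_apply, neg_eq_zero] at this
      rw [this, norm_zero] at h1
      exact zero_ne_one h1
  · have cross : ∀ p q : Fin h,
        star (blockLeft h N (Sum.inl p)) ⬝ᵥ blockLeft h N (Sum.inr q) = 0 ∨
        star (blockRight h N (Sum.inl p)) ⬝ᵥ blockRight h N (Sum.inr q) = 0 := by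
      intro p q
      by_cases H : ∃ t ≤ N, (h : ℤ) ∣ q - p - t
      · obtain ⟨t, ht, hd⟩ := H
        exact Or.inl (star_blockLeft_inl_inr (by omega) ht hd)
      · push Not at H
        exact Or.inr (star_blockRight_inl_inr hh H)
    rintro (p | p) (q | q) hpq
    · exact Or.inr (star_blockRight_inl_inl fun e => hpq (by rw [e]))
    · exact cross p q
    · exact (cross q p).imp star_dotProduct_eq_zero_comm.1 star_dotProduct_eq_zero_comm.1
    · exact Or.inr (star_blockRight_inr_inr hN hNh hpar fun e => hpq (by rw [e]))
  · intro x y hxy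
    by_cases hx : x = 0
    · exact Or.inl hx
    refine Or.inr (blockRight_eq_zero hN hNh hpar (le_trans (Finset.card_le_card ?_)
      (card_blockLeft_orthogonal_le hNh hpar hx)))
    intro i hi
    rw [Finset.mem_filter] at hi ⊢
    exact ⟨hi.1, (hxy i).resolve_right hi.2⟩

/-- Minimal unextendible families in `ℂ^d ⊗ ℂ^n` for `n ≡ d - 1 mod 4` and `n ≥ d + 3`. -/
theorem realizable_minimal {d n : ℕ} (hd : 3 ≤ d) (hdn : d + 3 ≤ n) (hmod : (n + 1) % 4 = d % 4) :
    Realizable d n ((d - 1) * (n - 1)) := by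
  obtain ⟨N, rfl⟩ : ∃ N, d = N + 2 := ⟨d - 2, by omega⟩
  -- The `2 * h` members number `d + n - 1`; the congruence mod `4` says that `N + h` is odd, and `d
  -- + 3 ≤ n` that `N + 3 ≤ h`.
  obtain ⟨h, hh⟩ : ∃ h, 2 * h = n + N + 1 := ⟨(n + N + 1) / 2, by omega⟩
  refine (isUnextendibleFamily_block (h := h) (N := N) (by omega) (by omega)
    (by omega)).realizable (by simp) (by simp; omega) ?_
  obtain ⟨k, rfl⟩ : ∃ k, n = k + 1 := ⟨n - 1, by omega⟩
  simp only [Fintype.card_sum, Fintype.card_fin]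
  rw [show h + h = k + 1 + N + 1 by omega]
  simp only [Nat.add_sub_cancel, show N + 2 - 1 = N + 1 by omega]
  ring

/-! ### Tiling the grid -/

theorem realizable_three_rows {x : ℕ} (h₁ : 4 ≤ x) (h₂ : x ≤ 5) : Realizable 3 4 x := by
  interval_cases x
  · exact realizable_three_three.mono le_rfl (by norm_num)
  · exact realizable_three_four

theorem realizable_four_rows {x : ℕ} (h₁ : 4 ≤ x) (h₂ : x ≤ 7) : Realizable 4 4 x := by
  interval_cases x
  · exact realizable_three_three.mono (by norm_num) (by norm_num)
  · exact realizable_three_four.mono (by norm_num) le_rfl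
  · exact realizable_four_four_six
  · exact realizable_four_four_seven

theorem realizable_four_cols {D : ℕ} (hD : 6 ≤ D) {x : ℕ} (h₁ : 4 ≤ x) (h₂ : x ≤ 5 * D / 3) :
    Realizable D 4 x := by
  induction D using Nat.strong_induction_on generalizing x with
  | _ D ih =>
    rcases le_or_gt x 7 with hx | hx
    · exact (realizable_four_rows h₁ hx).mono (by omega) le_rfl
    by_cases h6 : D = 6
    · subst h6
      have := (realizable_three_rows (x := 5 - (10 - x) / 2) (by omega) (by omega)).add_rows
        (realizable_three_rows (x := x - (5 - (10 - x) / 2)) (by omega) (by omega))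
      rwa [Nat.add_sub_cancel' (by omega)] at this
    by_cases h7 : D = 7
    · subst h7
      have := (realizable_three_rows (x := 4) le_rfl (by omega)).add_rows
        (realizable_four_rows (x := x - 4) (by omega) (by omega))
      rwa [Nat.add_sub_cancel' (by omega)] at this
    by_cases h8 : D = 8
    · subst h8
      have := (realizable_four_rows (x := x / 2) (by omega) (by omega)).add_rows
        (realizable_four_rows (x := x - x / 2) (by omega) (by omega))
      rwa [Nat.add_sub_cancel' (by omega)] at this
    -- Splitting off three rows with missing number `5` would leave `3`, below the minimum `4`.
    by_cases hx8 : x = 8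
    · exact (ih 6 (by omega) le_rfl h₁ (by omega)).mono hD le_rfl
    · have := (ih (D - 3) (by omega) (by omega) (x := x - 5) (by omega) (by omega)).add_rows
        (realizable_three_rows (x := 5) (by omega) le_rfl)
      rwa [Nat.sub_add_cancel (by omega), Nat.sub_add_cancel (by omega)] at this

theorem realizable_three_cols {D : ℕ} (hD : 6 ≤ D) : Realizable D 3 (D + D / 3) := by
  induction D using Nat.strong_induction_on with
  | _ D ih =>
    have r3 := realizable_three_three
    have r4 := realizable_three_four.swap
    by_cases h6 : D = 6
    · subst h6; exact r3.add_rows r3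
    by_cases h7 : D = 7
    · subst h7; exact r3.add_rows r4
    by_cases h8 : D = 8
    · subst h8; exact r4.add_rows r4
    have := (ih (D - 3) (by omega) (by omega)).add_rows r3
    rw [Nat.sub_add_cancel (by omega)] at this
    convert this using 1
    omega

theorem realizable_four_mul_cols {D C : ℕ} (hC : 7 ≤ C)
    (h : ∀ x, 4 ≤ x → x ≤ C → Realizable D 4 x) (k : ℕ) {x : ℕ} (h₁ : 4 ≤ x)
    (h₂ : x ≤ (k + 1) * C) : Realizable D (4 * (k + 1)) x := by
  induction k generalizing x with
  | zero => exact h x h₁ (by simpa using h₂)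
  | succ k ih =>
    rw [mul_add _ (k + 1)]
    rcases le_or_gt x ((k + 1) * C) with hx | hx
    · exact (ih h₁ hx).mono le_rfl (by omega)
    have hk : C ≤ (k + 1) * C := Nat.le_mul_of_pos_left C (by omega)
    have h₂' : x ≤ (k + 1) * C + C := by linarith
    -- Removing `C` could leave a remainder below `4`; removing `4` instead is safe since `x > C ≥
    -- 7`.
    by_cases hx4 : x < C + 4
    · have := (ih (x := x - 4) (by omega) (by omega)).add (h 4 le_rfl (by omega))
      rwa [Nat.sub_add_cancel (by omega)] at this
    · have := (ih (x := x - C) (by omega) (by omega)).add (h C (by omega) le_rfl)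
      rwa [Nat.sub_add_cancel (by omega)] at this

/-- For `D ≡ 2` mod `4` two minimal blocks of three columns fit; for `D ≡ 0` mod `4`, one of five
columns and a padding column. -/
theorem realizable_six_cols {D : ℕ} (hD : 6 ≤ D) (heven : Even D) :
    Realizable D 6 (4 * (D - 1)) := by
  obtain ⟨m, rfl⟩ := heven
  by_cases hm : m % 2 = 1
  · have := (realizable_minimal (d := 3) (n := m + m) le_rfl (by omega) (by omega)).swap
    have := this.add this
    convert this using 1
    omega
  · have := (realizable_minimal (d := 5) (n := m + m) (by omega) (by omega) (by omega)).swap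
    exact this.mono le_rfl (by omega)

/-- Each bound on `x` forces a number of available columns, through `cols`. Blocks of `4`, `3` and
`6` columns then cover the successive ranges of `x`, with total widths `8`, `11`, `12` and `13` for
`D ≥ 6`. -/
theorem realizable_residual {D K x : ℕ} (hD : 4 ≤ D) (heven : Even D)
    (hx : x = 0 ∨ 4 ≤ x) (hx' : x ≤ 6 * (D - 1) + 3) (hK : x ≤ (D - 1) * (K - 7)) :
    Realizable D K x := by
  rcases hx with rfl | hx
  · exact Realizable.zero D K
  have cols : ∀ j, j * (D - 1) < x → 7 + j < K := by
    intro j hj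
    by_contra! hlt
    have : (D - 1) * (K - 7) ≤ (D - 1) * j := Nat.mul_le_mul_left _ (by omega)
    rw [mul_comm] at hj
    omega
  have c0 := cols 0 (by omega)
  rcases hD.eq_or_lt with rfl | hD
  · have h4 : ∀ x, 4 ≤ x → x ≤ 7 → Realizable 4 4 x := fun x => realizable_four_rows
    by_cases h14 : x ≤ 14
    · exact (realizable_four_mul_cols le_rfl h4 1 hx (by omega)).mono le_rfl (by omega)
    · have := cols 4 (by omega)
      exact (realizable_four_mul_cols le_rfl h4 2 hx (by omega)).mono le_rfl (by omega)
  have h6 : 6 ≤ D := by obtain ⟨m, rfl⟩ := heven; omega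
  obtain ⟨C, hC⟩ : ∃ C, C = 5 * D / 3 := ⟨_, rfl⟩
  obtain ⟨M, hM⟩ : ∃ M, M = D + D / 3 := ⟨_, rfl⟩
  have h4 : ∀ x, 4 ≤ x → x ≤ C → Realizable D 4 x := fun x h₁ h₂ =>
    realizable_four_cols h6 h₁ (by omega)
  have h3 : Realizable D 3 M := hM ▸ realizable_three_cols h6
  have h8 : ∀ x, 4 ≤ x → x ≤ 2 * C → Realizable D 8 x := fun x h₁ h₂ =>
    realizable_four_mul_cols (by omega) h4 1 h₁ (by omega)
  by_cases r1 : x ≤ 2 * C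
  · exact (h8 x hx r1).mono le_rfl (by omega)
  have c3 := cols 3 (by omega)
  by_cases r2 : x ≤ 4 * (D - 1)
  · have := (h8 (x - M) (by omega) (by omega)).add h3
    rw [Nat.sub_add_cancel (by omega)] at this
    exact this.mono le_rfl (by omega)
  have c4 := cols 4 (by omega)
  by_cases r3 : x ≤ 3 * C
  · exact (realizable_four_mul_cols (by omega) h4 2 hx (by omega)).mono le_rfl (by omega)
  have c5 := cols 5 (by omega)
  have h7 : Realizable D 7 (x - 4 * (D - 1)) := by
    by_cases r4 : x - 4 * (D - 1) ≤ C
    · exact (h4 _ (by omega) r4).mono le_rfl (by omega)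
    by_cases r5 : x - 4 * (D - 1) < M + 4
    · have := (h4 (x - 4 * (D - 1) - 4) (by omega) (by omega)).add
        (realizable_three_three.mono (by omega : 3 ≤ D) le_rfl)
      rwa [Nat.sub_add_cancel (by omega)] at this
    · have := (h4 (x - 4 * (D - 1) - M) (by omega) (by omega)).add h3
      rwa [Nat.sub_add_cancel (by omega)] at this
  have := h7.add (realizable_six_cols h6 heven)
  rw [Nat.sub_add_cancel (by omega)] at this
  exact this.mono le_rfl (by omega)

/-- Minimal blocks exist for `n ≡ D + 1` mod `4` when `n ≤ D - 3` (factors swapped) and for `n ≡ D -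
1` mod `4` when `n ≥ D + 3`. A window of four consecutive integers contains a suitable `n`, except
where it picks `n = D + 1`, which is moved to `D + 3`. -/
theorem exists_minimal_cols {D q : ℕ} (hD : 4 ≤ D) (heven : Even D) (hq : 6 ≤ q) :
    ∃ n, 1 ≤ n ∧ n ≤ q + 1 ∧ q ≤ n + 4 ∧ Realizable D n ((D - 1) * (n - 1)) := by
  obtain ⟨m, rfl⟩ := heven
  have large : ∀ n, m + m + 3 ≤ n → (n + 1) % 4 = (m + m) % 4 →
      Realizable (m + m) n ((m + m - 1) * (n - 1)) :=
    fun n h₁ h₂ => realizable_minimal (by omega) h₁ h₂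
  have small : ∀ n, 3 ≤ n → n + 3 ≤ m + m → (m + m + 1) % 4 = n % 4 →
      Realizable (m + m) n ((m + m - 1) * (n - 1)) := by
    intro n h₁ h₂ h₃
    rw [mul_comm]
    exact (realizable_minimal h₁ h₂ h₃).swap
  -- Since `D` is even, `v` is odd; with `v ≥ 2` this gives the `3 ≤ v` that a swapped block
  -- requires.
  obtain ⟨v, hv1, hv2, hv3⟩ : ∃ v, q ≤ v + 4 ∧ v + 1 ≤ q ∧ v % 4 = (m + m + 1) % 4 :=
    ⟨q - 4 + (m + m + 1 + 3 * (q - 4)) % 4, by omega, by omega, by omega⟩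
  rcases le_or_gt (v + 3) (m + m) with h | h
  · exact ⟨v, by omega, by omega, by omega, small v (by omega) h hv3.symm⟩
  by_cases hv : v = m + m + 1
  · exact ⟨v + 2, by omega, by omega, by omega, large _ (by omega) (by omega)⟩
  · obtain ⟨w, hw1, hw2, hw3⟩ : ∃ w, q ≤ w + 4 ∧ w + 1 ≤ q ∧ (w + 1) % 4 = (m + m) % 4 :=
      ⟨q - 4 + (m + m + 3 + 3 * (q - 4)) % 4, by omega, by omega, by omega⟩
    exact ⟨w, by omega, by omega, by omega, large w (by omega) hw3⟩

/-- Dividing `s - 4` rather than `s` by `D - 1` keeps the residual at least `4`. The quotient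
exceeds `u` by at most `5`, so the residual is at most `4 + 5 * (D - 1) + (D - 2) = 6 * (D - 1) +
3`. -/
theorem realizable_of_le {D n s : ℕ} (hD : 4 ≤ D) (heven : Even D) (hs₄ : 4 ≤ s)
    (hs : s ≤ (D - 1) * (n - 8)) : Realizable D n s := by
  by_cases hsmall : s ≤ 6 * (D - 1) + 3
  · exact realizable_residual hD heven (Or.inr hs₄) hsmall
      (hs.trans (Nat.mul_le_mul_left _ (by omega)))
  have hE : 0 < D - 1 := by omega
  have hdiv := Nat.div_add_mod (s - 4) (D - 1)
  have hmod := Nat.mod_lt (s - 4) hE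
  have hq : 6 ≤ (s - 4) / (D - 1) := by
    rw [Nat.le_div_iff_mul_le hE]; omega
  obtain ⟨v, hv1, hv2, hv3, hR⟩ := exists_minimal_cols hD heven hq
  set q := (s - 4) / (D - 1)
  obtain ⟨u, rfl⟩ : ∃ u, v = u + 1 := ⟨v - 1, by omega⟩
  obtain ⟨w, hw⟩ : ∃ w, q = u + w := ⟨q - u, by omega⟩
  rw [Nat.add_sub_cancel] at hR
  have e1 : (D - 1) * q = (D - 1) * u + (D - 1) * w := by rw [hw, mul_add]
  have e2 : (D - 1) * w ≤ (D - 1) * 5 := Nat.mul_le_mul_left _ (by omega)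
  have hun : u < n - 8 := by
    by_contra! hle
    have := Nat.mul_le_mul_left (D - 1) hle
    omega
  obtain ⟨t, ht⟩ : ∃ t, n - 8 = u + t := ⟨n - 8 - u, by omega⟩
  have e3 : (D - 1) * (n - 8) = (D - 1) * u + (D - 1) * t := by rw [ht, mul_add]
  have := hR.add (realizable_residual (K := n - (u + 1)) (x := s - (D - 1) * u) hD heven
    (Or.inr (by omega)) (by omega) (by
      rw [show n - (u + 1) - 7 = t by omega]; omega))
  rwa [Nat.add_sub_cancel' (by omega), Nat.add_sub_cancel' (by omega)] at this

theorem theorem6 (m n : ℕ) (hm : 2 ≤ m) (hn : 10 ≤ n) (s : ℕ) (hs₄ : 4 ≤ s)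
    (hs : s ≤ (2 * m - 1) * (n - 8)) : HasUPBWithMissing (2 * m) n s := by
  exact (realizable_of_le (by omega) (even_two_mul m) hs₄ hs).hasUPBWithMissing (by omega)
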